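/- **Setting.** Let $F$ be a local field of characteristic $0$ (archimedean or not) and $E=F\times F$, with $\overline{(a,b)}=(b,a)$ and $F\subset E$ diagonally. Write $\operatorname{Tr}=\operatorname{Tr}_{E/F}$, $F^-=\{e\in E:\bar e=-e\}$, $A^*={}^t\!\bar A$, and $F_n,E_n$ (resp. $F^n,E^n$) for row (resp. column) vectors. Identify $\mathrm{GL}_n(E)=\mathrm{GL}_n(F)\times\mathrm{GL}_n(F)$ and $E_n=F_n\times F_n$. Fix $0\ne j\in F^-$, a nontrivial continuous additive character $\psi'$ of $F$, extended to $E$ by $\psi(x)=\psi'(\frac12\operatorname{Tr}x)$, and a continuous unitary character $\mu$ of $E^\times$ that is trivial on $F^\times$. Let $|\cdot|_F$, $|\cdot|_E$ be the normalized absolute values ($d(ax)=|a|\,dx$), $|j|=|j|_E^{1/2}$, and $\zeta_E(1)=\zeta_F(1)^2$. $\mathcal S$ denotes Schwartz functions ($C_c^\infty$ in the nonarchimedean case). **Measures.** $F$ and $E$ carry the self-dual measures for $\psi'$ and $\psi$; $F_n$ carries the product measure; $\mathrm{GL}_n(E)$ carries $dg=\zeta_E(1)|\det g|_E^{-n}\prod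 dx_{ij}$. Let $\beta=(1,-1)$, a skew-Hermitian matrix (over $E=F\times F$ all skew-Hermitian matrices in $\mathrm{GL}_n(E)$ are similar to it), and $U=\{h\in\mathrm{GL}_n(E):h^*\beta h=\beta\}=\{(g,{}^tg^{-1}):g\in\mathrm{GL}_n(F)\}$, with Lie algebra $\mathfrak u=\{(X,-{}^tX)\}$. Let $dX$ be the measure on $\mathfrak u$ that is self-dual for the pairing $\psi'(\operatorname{Tr}\operatorname{tr}(XY))$. Then $U$ carries the Haar measure whose pullback under the Cayley transform $X\mapsto(1+X)(1-X)^{-1}$ agrees with $dX$ at $X=0$. **Orbits.** A triple $[\xi,x,y]\in\mathrm{Mat}_n(E)\times E_n\times E^n$ is regular semisimple if $\xi$ has separable characteristic polynomial, the rows $x\xi^i$ ($0\le i<n$) span $E_n$ and the columns $\xi^iy$ ($0\le i<n$) span $E^n$. The group $\mathrm{GL}_n(E)$ acts by $[\xi,x,y].h=[h^{-1}\xi h,xh,h^{-1}y]$. Let $S\subset\mathrm{GL}_n(E)$ be a set of representatives $\gamma$, normal (i.e. $\bar\gamma\gamma\in\mathrm{GL}_n(F)$), of the $\sigma$-conjugacy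 classes ($\gamma\sim g^{-1}\gamma\bar g$) with $\bar\gamma\gamma$ regular semisimple. Let $R\subset\mathrm{GL}_n(E)$ be a set of representatives $\zeta$, normal (i.e. $\zeta$ commutes with $\beta^{-1}\zeta^*\beta\zeta$), of the $U\times U$-orbits ($\zeta\sim g^{-1}\zeta h$) with $\beta^{-1}\zeta^*\beta\zeta$ regular semisimple and of the form $\bar\gamma\gamma$ for some $\gamma\in\mathrm{GL}_n(E)$. Assume $S$ and $R$ are compatible: for $\gamma\in S$, $\zeta\in R$, $h\in\mathrm{GL}_n(E)$, if $\beta^{-1}\zeta^*\beta\zeta=h^{-1}\bar\gamma\gamma h$ then $\zeta=h^{-1}\gamma h$. For $\gamma\in S$, $x\in F_n$, $y\in(F^-)^n$ (a column) and $\zeta\in R$, $z\in E_n$, say that $[\gamma,x,y]\leftrightarrow[\zeta,z]$ (they match) if $[\bar\gamma\gamma,x,y]$ and $[\beta^{-1}\zeta^*\beta\zeta,z,\beta^{-1}z^*]$ are regular semisimple and in the same $\mathrm{GL}_n(E)$-orbit. **Orbital integrals.** For $f'\in C_c^\infty(\mathrm{GL}_n(E)\times\mathrm{GL}_n(E))$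 let $\widetilde{f'}(g)=\int_{\mathrm{GL}_n(E)}f'(gh,\bar h)\,dh$. For $\phi'\in\mathcal S(E_n)$ let $(R_\mu(g)\phi')(z)=\mu(\det g)|\det g|_E^{1/2}\phi'(zg)$ and $$\phi'^\dagger(x,y)=|j|^n\int_{F_n}\phi'(x+jw)\,\psi'(jwy)\,dw ,\qquad \mathrm{Orb}([\gamma,x,y],f',\phi')=\int_{\mathrm{GL}_n(E)}\widetilde{f'}(g^{-1}\gamma\bar g)\,\overline{(R_\mu(g)\phi')^\dagger(x,y)}\,dg .$$ For $\phi\in\mathcal S(F_n)$ and $h=(g,{}^tg^{-1})\in U$ let $(\omega(h)\phi)(x)=\mu(\det g,1)|\det g|_F^{1/2}\phi(xg)$ (the Weil representation of $U$ on $\mathcal S(\mathbb L)$, $\mathbb L=F_n\times\{0\}$). For $\phi_1,\phi_2\in\mathcal S(F_n)$, $z=(x,y)\in F_n\times F_n$ and $f\in C_c^\infty(\mathrm{GL}_n(E))$ let $$(\phi_1\otimes\phi_2)^\ddagger(z)=\int_{F_n}\phi_1(x+w)\phi_2(x-w)\,\psi'(w\,{}^ty)\,dw,$$ $$\mathrm{Orb}([\zeta,z],f,\phi_1\otimes\phi_2)=\iint_{U\times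 U}f(g^{-1}\zeta h)\,\bigl(\phi_2\otimes\overline{\omega(h^{-1}g)\phi_1}\bigr)^\ddagger(zh)\,dg\,dh .$$ **Proposition.** Let $f=f_1\otimes f_2$ with $f_1,f_2\in C_c^\infty(\mathrm{GL}_n(F))$, let ${}^tf_2(g)=f_2({}^tg)$, let $\phi_1,\phi_2\in\mathcal S(F_n)$, and suppose that $\widetilde{f'}=\zeta_E(1)^{-1}(f_1\otimes{}^tf_2)$ and $\phi'=\phi_1\otimes\overline{\phi_2}$. Then $(f',\phi')$ and $(f,\phi_1\otimes\phi_2)$ are smooth transfer of each other: whenever $[\gamma,x,y]\leftrightarrow[\zeta,z]$, $$\mathrm{Orb}([\gamma,x,y],f',\phi')=\mu\bigl(\det(x;\,x\xi;\,\dots;\,x\xi^{n-1})\bigr)\,\mathrm{Orb}([\zeta,z],f,\phi_1\otimes\phi_2),\qquad \xi=\bar\gamma\gamma .$$ Moreover, $\mathrm{Orb}([\gamma,x,y],f',\phi')=\mathrm{Orb}([\zeta,z],f,\phi_1\otimes\phi_2)$, and one of these two integrals converges absolutely if and only if the other does. -/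

import Mathlib

open MeasureTheory Matrix
open scoped ENNReal NNReal ContDiff

namespace SplitTransfer

noncomputable section

/-! ### Local fields: smooth functions, Schwartz functions, self-dual measures -/

section Analysis

variable (F : Type*) [NontriviallyNormedField F]

/-- Smooth complex functions on a finite-dimensional vector space `V` over a local field `F`:
locally constant if `F` is nonarchimedean, `C^∞` in the real sense if `F` is archimedean. -/
def IsSmooth {V : Type*} [NormedAddCommGroup V] [NormedSpace F V] (f : V → ℂ) : Prop :=
  (IsUltrametricDist F ∧ IsLocallyConstant f) ∨
    ∃ _ : NormedAlgebra ℝ F,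
      letI : NormedSpace ℝ V := NormedSpace.restrictScalars ℝ F V
      ContDiff ℝ ∞ f

/-- Schwartz functions on a finite-dimensional vector space `V` over a local field `F`:
locally constant with compact support if `F` is nonarchimedean, Schwartz in the usual
sense if `F` is archimedean. -/
def IsSchwartz {V : Type*} [NormedAddCommGroup V] [NormedSpace F V] (f : V → ℂ) : Prop :=
  (IsUltrametricDist F ∧ IsLocallyConstant f ∧ HasCompactSupport f) ∨
    ∃ _ : NormedAlgebra ℝ F,
      letI : NormedSpace ℝ V := NormedSpace.restrictScalars ℝ F V
      ∃ g : SchwartzMap V ℂ, ⇑g = f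

/-- `C_c^∞(X)` for a space `X` with an open embedding `e` into a finite-dimensional `F`-vector
space: compact support, and the extension by zero along `e` is smooth. -/
def IsTestFunction {X V : Type*} [TopologicalSpace X] [NormedAddCommGroup V] [NormedSpace F V]
    (e : X → V) (f : X → ℂ) : Prop :=
  HasCompactSupport f ∧ IsSmooth F (Function.extend e f 0)

/-- `ν` is the self-dual Haar measure on `V` for the Fourier transform
`φ^(y) = ∫ φ(x) χ(x, y) dν(x)`, i.e. `φ^^(z) = φ(-z)` for all Schwartz functions `φ`. -/
structure IsSelfDual {V : Type*} [NormedAddCommGroup V] [NormedSpace F V] [MeasurableSpace V]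
    (χ : V → V → Circle) (ν : Measure V) : Prop where
  haar : ν.IsAddHaarMeasure
  inversion : ∀ φ : V → ℂ, IsSchwartz F φ → ∀ z : V,
    ∫ y, (∫ x, φ x * (χ x y : ℂ) ∂ν) * (χ y z : ℂ) ∂ν = φ (-z)

open Classical in
/-- The value `ζ_F(1)` of the local zeta function: `(1 - q⁻¹)⁻¹` with `q` the cardinality of the
residue field if `F` is nonarchimedean, `π^(-1/2) Γ(1/2) = 1` if `F` is real, and
`2 (2π)⁻¹ Γ(1) = 1/π` if `F` is complex. -/
def zetaOne : ℝ :=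
  if _h : IsUltrametricDist F then
    (1 - (Nat.card (IsLocalRing.ResidueField
      (NormedField.valuation (K := F)).valuationSubring) : ℝ)⁻¹)⁻¹
  else if ∃ i : F, i ^ 2 = -1 then Real.pi⁻¹ else 1

/-- `ζ_E(1)` for `E = F × F`. -/
def zetaOneE : ℝ := zetaOne F * zetaOne F

end Analysis

/-! ### The groups `GL_n(R)` and their measures, for `R = F` and `R = E = F × F` -/

section GLMeasure

instance {n : ℕ} {R : Type*} [CommRing R] [TopologicalSpace R] :
    MeasurableSpace (GL (Fin n) R) := borel _

instance {n : ℕ} {R : Type*} [CommRing R] [TopologicalSpace R] :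
    BorelSpace (GL (Fin n) R) := ⟨rfl⟩

/-- The matrix entries of an element of `GL_n(R)`, i.e. the embedding of `GL_n(R)` in the
`R`-module `R^{n × n}`. -/
def entries {n : ℕ} {R : Type*} [CommRing R] (g : GL (Fin n) R) : Fin n → Fin n → R :=
  fun i j => (g : Matrix (Fin n) (Fin n) R) i j

variable {R : Type*} [CommRing R] [TopologicalSpace R] [IsTopologicalRing R]
  [LocallyCompactSpace R]

open Classical in
/-- The normalized absolute value of `R`: `d(ax) = |a| dx` for Haar measures `dx` on `R`
(and `|a| = 0` if `a` is not a unit). -/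
def modulus (a : R) : ℝ≥0 :=
  if h : IsUnit a then distribHaarChar R h.unit else 0

/-- The measure `|det g|^{-n} ∏ dx_{ij}` on `GL_n(R)`, where `∏ dx_{ij}` is a given measure on
`R^{n × n}`. -/
def detMeasure {n : ℕ} [MeasurableSpace R] (ν : Measure (Fin n → Fin n → R)) :
    Measure (GL (Fin n) R) :=
  (ν.withDensity fun A => ((modulus (Matrix.of A).det ^ n)⁻¹ : ℝ≥0)).comap entries

end GLMeasure

/-! ### The split quadratic algebra `E = F × F` -/

section SplitAlgebra

variable {F : Type*} [Field F] {n : ℕ}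

/-- The nontrivial automorphism of `E = F × F` over `F`. -/
def conj : F × F ≃+* F × F := RingEquiv.prodComm

/-- The trace of `E = F × F` over `F`. -/
def trE (a : F × F) : F := a.1 + a.2

/-- Conjugation on `GL_n(E)`. -/
def conjGL : GL (Fin n) (F × F) →* GL (Fin n) (F × F) :=
  GeneralLinearGroup.map (conj (F := F)).toRingHom

/-- The conjugate transpose `A^*`. -/
def star' {l m : Type*} (A : Matrix l m (F × F)) : Matrix m l (F × F) := (A.map conj)ᵀ

/-- The projections of `GL_n(E) = GL_n(F) × GL_n(F)`. -/
def fstGL : GL (Fin n) (F × F) →* GL (Fin n) F := GeneralLinearGroup.map (RingHom.fst F F)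

/-- The projections of `GL_n(E) = GL_n(F) × GL_n(F)`. -/
def sndGL : GL (Fin n) (F × F) →* GL (Fin n) F := GeneralLinearGroup.map (RingHom.snd F F)

/-- The pair of matrices `(A, B)` as a matrix over `E = F × F`. -/
def pairMat (A B : Matrix (Fin n) (Fin n) F) : Matrix (Fin n) (Fin n) (F × F) :=
  Matrix.of fun i j => (A i j, B i j)

lemma pairMat_mul (A B C D : Matrix (Fin n) (Fin n) F) :
    pairMat A B * pairMat C D = pairMat (A * C) (B * D) := by
  ext i j <;> simp [pairMat, Matrix.mul_apply, Prod.fst_sum, Prod.snd_sum]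

lemma pairMat_one : pairMat (1 : Matrix (Fin n) (Fin n) F) 1 = 1 := by
  ext i j <;> by_cases h : i = j <;> simp [pairMat, Matrix.one_apply, h]

/-- The element `(g, h)` of `GL_n(E) = GL_n(F) × GL_n(F)`. -/
def pairGL (g h : GL (Fin n) F) : GL (Fin n) (F × F) where
  val := pairMat g h
  inv := pairMat (g⁻¹ : GL (Fin n) F) (h⁻¹ : GL (Fin n) F)
  val_inv := by rw [pairMat_mul, Units.mul_inv, Units.mul_inv, pairMat_one]
  inv_val := by rw [pairMat_mul, Units.inv_mul, Units.inv_mul, pairMat_one]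

/-- The transpose of an element of `GL_n(F)`. -/
def transposeGL (g : GL (Fin n) F) : GL (Fin n) F where
  val := (g : Matrix (Fin n) (Fin n) F)ᵀ
  inv := ((g⁻¹ : GL (Fin n) F) : Matrix (Fin n) (Fin n) F)ᵀ
  val_inv := by rw [← Matrix.transpose_mul, Units.inv_mul, Matrix.transpose_one]
  inv_val := by rw [← Matrix.transpose_mul, Units.mul_inv, Matrix.transpose_one]

/-- The unit `(a, b)` of `E = F × F`. -/
def pairUnit (a b : Fˣ) : (F × F)ˣ := MulEquiv.prodUnits.symm (a, b)

/-- A vector over `F` seen as a vector over `E`, through the diagonal embedding `F ⊆ E`. -/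
def toE (x : Fin n → F) : Fin n → F × F := fun i => algebraMap F (F × F) (x i)

end SplitAlgebra

/-! ### Orbits -/

section Orbits

variable {F : Type*} [Field F] {n : ℕ}

/-- A square matrix over `E` is regular semisimple if its characteristic polynomial is
separable. -/
def IsRegSemisimple (ξ : Matrix (Fin n) (Fin n) (F × F)) : Prop := ξ.charpoly.Separable

/-- Regular semisimple elements `[ξ, x, y]` of
`M_n(E) = Mat_n(E) × Mat_{1,n}(E) × Mat_{n,1}(E)`. -/
structure IsRssTriple (ξ : Matrix (Fin n) (Fin n) (F × F)) (x y : Fin n → F × F) : Prop where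
  regSemisimple : IsRegSemisimple ξ
  span_row : Submodule.span (F × F) (Set.range fun i : Fin n => x ᵥ* ξ ^ (i : ℕ)) = ⊤
  span_col : Submodule.span (F × F) (Set.range fun i : Fin n => ξ ^ (i : ℕ) *ᵥ y) = ⊤

/-- `[ξ, x, y]` and `[ξ', x', y']` are in the same orbit of `GL_n(E)` acting on `M_n(E)` by
`[ξ, x, y].h = [h⁻¹ ξ h, x h, h⁻¹ y]`. -/
def SameOrbit (ξ : Matrix (Fin n) (Fin n) (F × F)) (x y : Fin n → F × F)
    (ξ' : Matrix (Fin n) (Fin n) (F × F)) (x' y' : Fin n → F × F) : Prop :=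
  ∃ h : GL (Fin n) (F × F),
    ξ' = h⁻¹.val * ξ * h.val ∧ x' = x ᵥ* h.val ∧ y' = h⁻¹.val *ᵥ y

/-- The norm map `Nm(γ) = γ̄ γ` on `GL_n(E)`. -/
def Nm (γ : GL (Fin n) (F × F)) : GL (Fin n) (F × F) := conjGL γ * γ

/-- `γ` is normal if `γ̄ γ` lies in `GL_n(F)`. -/
def IsNormal (γ : GL (Fin n) (F × F)) : Prop :=
  ∃ δ : GL (Fin n) F, Nm γ = GeneralLinearGroup.map (algebraMap F (F × F)) δ

/-- `γ` and `γ'` are `σ`-conjugate: `γ' = g⁻¹ γ ḡ` for some `g`. -/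
def SigmaConj (γ γ' : GL (Fin n) (F × F)) : Prop :=
  ∃ g : GL (Fin n) (F × F), γ' = g⁻¹ * γ * conjGL g

/-- `S` is a set of normal representatives of the regular semisimple `σ`-conjugacy classes of
`GL_n(E)`. -/
structure IsGLReps (S : Set (GL (Fin n) (F × F))) : Prop where
  normal : ∀ γ ∈ S, IsNormal γ
  regSemisimple : ∀ γ ∈ S, IsRegSemisimple (Nm γ).val
  eq_of_sigmaConj : ∀ γ ∈ S, ∀ γ' ∈ S, SigmaConj γ γ' → γ = γ'
  exists_sigmaConj : ∀ γ, IsRegSemisimple (Nm γ).val → ∃ γ' ∈ S, SigmaConj γ γ'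

/-- `β` is skew-Hermitian. -/
def IsSkewHermitian (β : GL (Fin n) (F × F)) : Prop := star' β.val = -β.val

/-- The unitary group `U_n^β(F) = {h ∈ GL_n(E) : h^* β h = β}`. -/
def unitaryGroup (β : GL (Fin n) (F × F)) : Subgroup (GL (Fin n) (F × F)) where
  carrier := {h | star' h.val * β.val * h.val = β.val}
  one_mem' := by simp [star']
  mul_mem' := by
    intro a b ha hb
    simp only [Set.mem_ofPred_eq] at ha hb ⊢
    have hs : star' (a * b).val = star' b.val * star' a.val := by
      simp [star', ← Matrix.transpose_mul, Matrix.map_mul]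
    rw [hs, Units.val_mul]
    calc star' b.val * star' a.val * β.val * (a.val * b.val)
        = star' b.val * (star' a.val * β.val * a.val) * b.val := by noncomm_ring
      _ = β.val := by rw [ha, hb]
  inv_mem' := by
    intro a ha
    simp only [Set.mem_ofPred_eq] at ha ⊢
    have hs : star' a⁻¹.val * star' a.val = 1 := by
      simp only [star', ← Matrix.transpose_mul, ← Matrix.map_mul, Units.mul_inv]
      simp
    calc star' a⁻¹.val * β.val * a⁻¹.val
        = star' a⁻¹.val * (star' a.val * β.val * a.val) * a⁻¹.val := by rw [ha]
      _ = (star' a⁻¹.val * star' a.val) * β.val * (a.val * a⁻¹.val) := by noncomm_ring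
      _ = β.val := by rw [hs, Units.mul_inv, one_mul, mul_one]

/-- The matrix `β⁻¹ ζ^* β ζ`. -/
def hermNorm (β ζ : GL (Fin n) (F × F)) : Matrix (Fin n) (Fin n) (F × F) :=
  β⁻¹.val * star' ζ.val * β.val * ζ.val

/-- The column vector `β⁻¹ z^*` of a row vector `z`. -/
def dualCol (β : GL (Fin n) (F × F)) (z : Fin n → F × F) : Fin n → F × F :=
  β⁻¹.val *ᵥ fun i => conj (z i)

/-- `ζ` is normal with respect to `β` if it commutes with `β⁻¹ ζ^* β ζ`. -/
def IsNormalWrt (β ζ : GL (Fin n) (F × F)) : Prop := Commute ζ.val (hermNorm β ζ)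

/-- `ζ` and `ζ'` are in the same orbit of `U_n^β(F) × U_n^β(F)`: `ζ' = g⁻¹ ζ h`. -/
def UnitaryEquiv (β ζ ζ' : GL (Fin n) (F × F)) : Prop :=
  ∃ g ∈ unitaryGroup β, ∃ h ∈ unitaryGroup β, ζ' = g⁻¹ * ζ * h

/-- The regular semisimple `ζ` such that `β⁻¹ ζ^* β ζ` is in the image of the norm map. -/
def IsRssNorm (β ζ : GL (Fin n) (F × F)) : Prop :=
  IsRegSemisimple (hermNorm β ζ) ∧ ∃ γ : GL (Fin n) (F × F), (Nm γ).val = hermNorm β ζ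

/-- `R` is a set of normal representatives of the regular semisimple
`U_n^β(F) × U_n^β(F)`-orbits of elements `ζ` of `GL_n(E)` with `β⁻¹ ζ^* β ζ ∈ Nm(GL_n(E))`. -/
structure IsUnitaryReps (β : GL (Fin n) (F × F)) (R : Set (GL (Fin n) (F × F))) : Prop where
  normal : ∀ ζ ∈ R, IsNormalWrt β ζ
  rssNorm : ∀ ζ ∈ R, IsRssNorm β ζ
  eq_of_equiv : ∀ ζ ∈ R, ∀ ζ' ∈ R, UnitaryEquiv β ζ ζ' → ζ = ζ'
  exists_equiv : ∀ ζ, IsRssNorm β ζ → ∃ ζ' ∈ R, UnitaryEquiv β ζ ζ'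

/-- Compatibility of the sets of representatives `S` and `R`. -/
def Compatible (β : GL (Fin n) (F × F)) (S R : Set (GL (Fin n) (F × F))) : Prop :=
  ∀ γ ∈ S, ∀ ζ ∈ R, ∀ h : GL (Fin n) (F × F),
    hermNorm β ζ = h⁻¹.val * (Nm γ).val * h.val → ζ = h⁻¹ * γ * h

/-- `[γ, x, y] ∈ X_rss`: `γ ∈ S`, `x ∈ F_n`, `y` is a column of purely imaginary elements of `E`,
and `[γ̄ γ, x, y]` is regular semisimple. -/
structure IsRssGL (S : Set (GL (Fin n) (F × F))) (γ : GL (Fin n) (F × F)) (x : Fin n → F)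
    (y : Fin n → F × F) : Prop where
  mem : γ ∈ S
  imaginary : ∀ i, conj (y i) = -y i
  rss : IsRssTriple (Nm γ).val (toE x) y

/-- `[ζ, z] ∈ Y^β_rss`: `ζ ∈ R` and `[β⁻¹ ζ^* β ζ, z, β⁻¹ z^*]` is regular semisimple. -/
structure IsRssUnitary (β : GL (Fin n) (F × F)) (R : Set (GL (Fin n) (F × F)))
    (ζ : GL (Fin n) (F × F)) (z : Fin n → F × F) : Prop where
  mem : ζ ∈ R
  rss : IsRssTriple (hermNorm β ζ) z (dualCol β z)

/-- The matching `[γ, x, y] ↔ [ζ, z]^β` of regular semisimple classes. -/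
structure Matches (β : GL (Fin n) (F × F)) (S R : Set (GL (Fin n) (F × F)))
    (γ : GL (Fin n) (F × F)) (x : Fin n → F) (y : Fin n → F × F)
    (ζ : GL (Fin n) (F × F)) (z : Fin n → F × F) : Prop where
  rssGL : IsRssGL S γ x y
  rssUnitary : IsRssUnitary β R ζ z
  sameOrbit : SameOrbit (Nm γ).val (toE x) y (hermNorm β ζ) z (dualCol β z)

variable (F n) in
/-- The skew-Hermitian matrix `β = (1, -1)`. -/
def betaSplit : GL (Fin n) (F × F) := pairGL 1 (-1)

/-- Over `E = F × F`, the skew-Hermitian matrices form one similarity class, the one of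
`(1, -1)`; so a family of functions indexed by similarity classes is a single function. -/
lemma exists_eq_star_mul_betaSplit_mul (β : GL (Fin n) (F × F)) (hβ : IsSkewHermitian β) :
    ∃ a : GL (Fin n) (F × F), β.val = star' a.val * (betaSplit F n).val * a.val := by
  refine ⟨pairGL (fstGL β) 1, ?_⟩
  have hs : star' (pairGL (fstGL β) 1).val
      = pairMat 1 (fstGL β : Matrix (Fin n) (Fin n) F)ᵀ := by
    ext i j <;> by_cases h : i = j <;>
      simp [star', pairGL, pairMat, conj, Matrix.one_apply, h, eq_comm]
  have hb : (betaSplit F n).val = pairMat 1 (-1) := rfl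
  have hp : (pairGL (fstGL β) 1).val = pairMat (fstGL β : Matrix (Fin n) (Fin n) F) 1 := rfl
  rw [hs, hb, hp, pairMat_mul, pairMat_mul]
  ext i j
  · simp [pairMat, fstGL]
  · have h := congrArg Prod.snd (congrFun (congrFun hβ i) j)
    simp [star', conj] at h
    simp [pairMat, fstGL, h]

/-- The parametrization `g ↦ (g, ᵗg⁻¹)` of `U(V)(F)` for `β = (1, -1)` by `GL_n(F)`. -/
def toUnitary (g : GL (Fin n) F) : unitaryGroup (betaSplit F n) :=
  ⟨pairGL g (transposeGL g⁻¹), by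
    change star' (pairMat _ _) * pairMat 1 (-1) * pairMat _ _ = pairMat 1 (-1)
    have hs : star' (pairMat g.val (transposeGL g⁻¹).val) = pairMat g⁻¹.val g.valᵀ := by
      ext i j <;> simp [star', pairMat, conj, transposeGL]
    rw [hs, pairMat_mul, pairMat_mul]
    have h2 : g.valᵀ * (transposeGL g⁻¹).val = 1 := by
      change g.valᵀ * g⁻¹.valᵀ = 1
      rw [← Matrix.transpose_mul, Units.inv_mul, Matrix.transpose_one]
    simp [h2]⟩

/-- The parametrization `X ↦ (X, -ᵗX)` of the Lie algebra `𝔲(V)(F)` for `β = (1, -1)` by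
`Mat_n(F)`. -/
def toLie (X : Fin n → Fin n → F) : Matrix (Fin n) (Fin n) (F × F) :=
  pairMat (Matrix.of X) (-(Matrix.of X)ᵀ)

/-- The symplectic form on the dual `(Res_{E/F} V)^∨ = E_n` of `V = E^n`, whose form is given
by `β`: `⟨z, z'⟩ = Tr_{E/F}(z β⁻¹ z'^*)`. -/
def symp (β : GL (Fin n) (F × F)) (z z' : Fin n → F × F) : F := trE (z ⬝ᵥ dualCol β z')

/-- The identification of `F_n` with the Lagrangian `𝕃 = F_n × {0}` of `E_n`. -/
def inL (x : Fin n → F) : Fin n → F × F := fun i => (x i, 0)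

/-- The identification of `F_n` with the Lagrangian `𝕃^∨ = {0} × F_n` of `E_n`. -/
def inLdual (y : Fin n → F) : Fin n → F × F := fun i => (0, y i)

end Orbits

/-! ### Representations, partial Fourier transforms and orbital integrals -/

section Integrals

variable {F : Type*} [NontriviallyNormedField F] [ProperSpace F] [MeasurableSpace F]
  [BorelSpace F] {n : ℕ}

/-- The additive character `ψ(x) = ψ'(½ Tr x)` of `E`, which extends `ψ'`. -/
def psiE (ψ' : AddChar F Circle) (a : F × F) : Circle := ψ' (trE a / 2)

/-- The measure `dg = ζ_E(1) |det g|_E^{-n} ∏ dx_{ij}` on `GL_n(E)`, for a measure `dxE` on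
`E`. -/
def measureGLE (dxE : Measure (F × F)) : Measure (GL (Fin n) (F × F)) :=
  ENNReal.ofReal (zetaOneE F) •
    detMeasure (Measure.pi fun _ : Fin n => Measure.pi fun _ : Fin n => dxE)

/-- The pairing `(X, Y) ↦ ψ'(Tr(XY))` on `𝔲(V)(F)`, in the coordinates `toLie`. Here `Tr(XY)` is
the trace of `XY` over `F`, that is `Tr_{E/F}` of the trace of the matrix `XY`. -/
def liePairing (ψ' : AddChar F Circle) (X Y : Fin n → Fin n → F) : Circle :=
  ψ' (trE (Matrix.trace (toLie X * toLie Y)))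

/-- The Cayley transform `X ↦ (1 + X)(1 - X)⁻¹` has differential `2` at `X = 0`. -/
lemma cayley_eq {A : Type*} [Ring A] (X u : A) (hu : (1 - X) * u = 1) :
    (1 + X) * u = 1 + 2 * X + 2 * X ^ 2 * u := by
  have h : (1 + X) * u = (1 + 2 * X) * ((1 - X) * u) + 2 * X ^ 2 * u := by noncomm_ring
  rw [h, hu, mul_one]

/-- The Haar measure `|ω|` on `U(V)(F)`, `β = (1, -1)`, whose pullback by the Cayley transform
agrees at `X = 0` with the measure `dX` on `𝔲(V)(F)`. Here `dX` is given in the coordinates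
`toLie`. In the coordinates `toUnitary`, an invariant top form is `c (det g)^{-n} ⋀ dg_{ij}`; as
the Cayley transform has differential `2` at `0`, its pullback at `0` is `2^{n²} c ⋀ dX_{ij}`. -/
def measureU (dX : Measure (Fin n → Fin n → F)) : Measure (unitaryGroup (betaSplit F n)) :=
  (((modulus (2 : F) ^ (n ^ 2))⁻¹ : ℝ≥0) • detMeasure dX).map toUnitary

/-- The function `f̃'` on `GL_n(E)` attached to a function `f'` on
`G'(F) = GL_n(E) × GL_n(E)`: `f̃'(g) = ∫ f'((g, 1)(h, h̄)) dh`. -/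
def tilde (dxE : Measure (F × F)) (f' : GL (Fin n) (F × F) × GL (Fin n) (F × F) → ℂ)
    (g : GL (Fin n) (F × F)) : ℂ :=
  ∫ h, f' ((g, 1) * (h, conjGL h)) ∂measureGLE dxE

/-- The representation `(R_μ(g) φ')(z) = μ(det g) |det g|_E^{1/2} φ'(z g)`. -/
def repGL (μ : (F × F)ˣ →* Circle) (g : GL (Fin n) (F × F)) (φ' : (Fin n → F × F) → ℂ)
    (z : Fin n → F × F) : ℂ :=
  (μ (GeneralLinearGroup.det g) : ℂ) * (Real.sqrt (modulus g.val.det) : ℂ) * φ' (z ᵥ* g.val)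

/-- The partial Fourier transform
`φ'^†(x, y) = |j|^n ∫_{F_n} φ'(x + j w) ψ'(j w y) dw` for `x ∈ F_n` and `y` purely imaginary. Here
`|j| = |j|_E^{1/2}` extends the absolute value of `F`, and `ψ` extends `ψ'`. -/
def dagger (ψ' : AddChar F Circle) (dx : Measure F) (j : F × F) (φ' : (Fin n → F × F) → ℂ)
    (x : Fin n → F) (y : Fin n → F × F) : ℂ :=
  (Real.sqrt (modulus j) ^ n : ℝ) *
    ∫ w : Fin n → F, φ' (toE x + j • toE w) * (psiE ψ' (j * (toE w ⬝ᵥ y)) : ℂ)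
      ∂(Measure.pi fun _ => dx)

/-- The integrand of the orbital integral on the general linear side. -/
def integrandGL (ψ' : AddChar F Circle) (μ : (F × F)ˣ →* Circle) (dx : Measure F)
    (dxE : Measure (F × F)) (j : F × F) (s : ℂ) (γ : GL (Fin n) (F × F)) (x : Fin n → F)
    (y : Fin n → F × F) (f' : GL (Fin n) (F × F) × GL (Fin n) (F × F) → ℂ)
    (φ' : (Fin n → F × F) → ℂ) (g : GL (Fin n) (F × F)) : ℂ :=
  tilde dxE f' (g⁻¹ * γ * conjGL g) *
    starRingEnd ℂ (dagger ψ' dx j (repGL μ g φ') x y *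
      (((modulus g.val.det : ℝ) : ℂ) ^ (s - 1 / 2)))

/-- The orbital integral `Orb(s, [γ, x, y], f', φ')` on the general linear side. -/
def orbGL (ψ' : AddChar F Circle) (μ : (F × F)ˣ →* Circle) (dx : Measure F)
    (dxE : Measure (F × F)) (j : F × F) (s : ℂ) (γ : GL (Fin n) (F × F)) (x : Fin n → F)
    (y : Fin n → F × F) (f' : GL (Fin n) (F × F) × GL (Fin n) (F × F) → ℂ)
    (φ' : (Fin n → F × F) → ℂ) : ℂ :=
  ∫ g, integrandGL ψ' μ dx dxE j s γ x y f' φ' g ∂measureGLE dxE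

/-- The Weil representation `ω_{ψ', μ}` of `U(V)(F) = {(g, ᵗg⁻¹)}`, `β = (1, -1)`, realized on
functions on `𝕃 = F_n`. As `U(V)` preserves `𝕃` and `𝕃^∨`, the splitting over `U(V)` of the
metaplectic cover given by `μ` is `ω((g, ᵗg⁻¹)) φ(x) = μ(det g, 1) |det g|^{1/2} φ(x g)`. -/
def weil (μ : (F × F)ˣ →* Circle) (h : unitaryGroup (betaSplit F n)) (φ : (Fin n → F) → ℂ)
    (x : Fin n → F) : ℂ :=
  (μ (pairUnit (GeneralLinearGroup.det (fstGL h.val)) 1) : ℂ) *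
    (Real.sqrt (modulus (fstGL h.val).val.det) : ℂ) * φ (x ᵥ* (fstGL h.val).val)

/-- The operators of the Heisenberg group on functions on `𝕃`, in the Schrödinger model:
`ρ(x, y) φ(w) = ψ'(⟨w + x/2, y⟩) φ(w + x)`. -/
def heisenberg (ψ' : AddChar F Circle) (z : Fin n → F × F) (φ : (Fin n → F) → ℂ)
    (w : Fin n → F) : ℂ :=
  (ψ' (symp (betaSplit F n) (inL (w + (2 : F)⁻¹ • fun i => (z i).1))
    (inLdual fun i => (z i).2)) : ℂ) * φ (w + fun i => (z i).1)

/-- The partial Fourier transform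
`(φ₁ ⊗ φ₂)^‡(z) = ∫_𝕃 φ₁(x + w) φ₂(x - w) ψ'(⟨w, y⟩) dw`, where `z = (x, y)` with `x ∈ 𝕃` and
`y ∈ 𝕃^∨`. -/
def ddagger (ψ' : AddChar F Circle) (dx : Measure F) (φ₁ φ₂ : (Fin n → F) → ℂ)
    (z : Fin n → F × F) : ℂ :=
  ∫ w : Fin n → F, φ₁ ((fun i => (z i).1) + w) * φ₂ ((fun i => (z i).1) - w) *
    (ψ' (symp (betaSplit F n) (inL w) (inLdual fun i => (z i).2)) : ℂ)
      ∂(Measure.pi fun _ => dx)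

/-- The integrand of the orbital integral on the unitary side, for `β = (1, -1)`. -/
def integrandU (ψ' : AddChar F Circle) (μ : (F × F)ˣ →* Circle) (dx : Measure F)
    (ζ : GL (Fin n) (F × F)) (z : Fin n → F × F) (f : GL (Fin n) (F × F) → ℂ)
    (φ₁ φ₂ : (Fin n → F) → ℂ)
    (p : unitaryGroup (betaSplit F n) × unitaryGroup (betaSplit F n)) : ℂ :=
  f (p.1.val⁻¹ * ζ * p.2.val) *
    ddagger ψ' dx φ₂ (fun w => starRingEnd ℂ (weil μ (p.2⁻¹ * p.1) φ₁ w)) (z ᵥ* p.2.val.val)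

/-- The orbital integral `Orb([ζ, z], f, φ₁ ⊗ φ₂)` on the unitary side, for `β = (1, -1)`. -/
def orbU (ψ' : AddChar F Circle) (μ : (F × F)ˣ →* Circle) (dx : Measure F)
    (dX : Measure (Fin n → Fin n → F)) (ζ : GL (Fin n) (F × F)) (z : Fin n → F × F)
    (f : GL (Fin n) (F × F) → ℂ) (φ₁ φ₂ : (Fin n → F) → ℂ) : ℂ :=
  ∫ p, integrandU ψ' μ dx ζ z f φ₁ φ₂ p ∂((measureU dX).prod (measureU dX))

open Classical in
/-- The transfer factor `μ(det(x; xξ; …; xξ^{n-1}))` of a regular semisimple `[ξ, x, y]`. -/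
def transferFactor (μ : (F × F)ˣ →* Circle) (ξ : Matrix (Fin n) (Fin n) (F × F))
    (x : Fin n → F × F) : ℂ :=
  if h : IsUnit (Matrix.of fun i : Fin n => x ᵥ* ξ ^ (i : ℕ)).det then (μ h.unit : ℂ) else 0

/-- `(f', φ')` and `(f, φ₁ ⊗ φ₂)` are smooth transfer of each other, with respect to the sets of
representatives `S` and `R`. -/
def IsSmoothTransfer (ψ' : AddChar F Circle) (μ : (F × F)ˣ →* Circle) (dx : Measure F)
    (dxE : Measure (F × F)) (dX : Measure (Fin n → Fin n → F)) (j : F × F)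
    (S R : Set (GL (Fin n) (F × F)))
    (f' : GL (Fin n) (F × F) × GL (Fin n) (F × F) → ℂ) (φ' : (Fin n → F × F) → ℂ)
    (f : GL (Fin n) (F × F) → ℂ) (φ₁ φ₂ : (Fin n → F) → ℂ) : Prop :=
  ∀ γ x y ζ z, Matches (betaSplit F n) S R γ x y ζ z →
    orbGL ψ' μ dx dxE j (1 / 2) γ x y f' φ' =
      transferFactor μ (Nm γ).val (toE x) * orbU ψ' μ dx dX ζ z f φ₁ φ₂

/-- `weil` is a homomorphism. -/
lemma weil_mul (μ : (F × F)ˣ →* Circle) (h k : unitaryGroup (betaSplit F n))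
    (φ : (Fin n → F) → ℂ) : weil μ (h * k) φ = weil μ h (weil μ k φ) := by
  have hu : ∀ a b : Fˣ, pairUnit (a * b) 1 = pairUnit a 1 * pairUnit b 1 := by
    intro a b
    simp [pairUnit, ← map_mul]
  have hm : ∀ a : GL (Fin n) F, modulus a.val.det
      = distribHaarChar F (GeneralLinearGroup.det a) := by
    intro a
    have ha : IsUnit a.val.det := (GeneralLinearGroup.det a).isUnit
    rw [modulus, dif_pos ha]
    congr 1
    ext
    simp
  funext x
  have hq : (Real.sqrt (modulus (fstGL (h * k).val).val.det) : ℂ) =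
      (Real.sqrt (modulus (fstGL h.val).val.det) : ℂ) *
        (Real.sqrt (modulus (fstGL k.val).val.det) : ℂ) := by
    simp only [hm, Subgroup.coe_mul, map_mul, NNReal.coe_mul]
    rw [Real.sqrt_mul (NNReal.coe_nonneg _), Complex.ofReal_mul]
  simp only [weil, hq]
  simp only [Subgroup.coe_mul, map_mul, hu, Circle.coe_mul, Units.val_mul,
    Matrix.vecMul_vecMul]
  ring

/-- `weil` is compatible with the Heisenberg group: `ρ(z) ω(h) = ω(h) ρ(z h)` for `z ∈ E_n` and
`h ∈ U(V)(F)`. So `ω(h)` is an operator of the Weil representation attached to `h`. -/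
lemma heisenberg_weil (ψ' : AddChar F Circle) (μ : (F × F)ˣ →* Circle)
    (h : unitaryGroup (betaSplit F n)) (z : Fin n → F × F) (φ : (Fin n → F) → ℂ) :
    heisenberg ψ' z (weil μ h φ) = weil μ h (heisenberg ψ' (z ᵥ* h.val.val) φ) := by
  have hsymp : ∀ u v : Fin n → F, symp (betaSplit F n) (inL u) (inLdual v) = u ⬝ᵥ v := by
    intro u v
    have hb : (betaSplit F n)⁻¹.val = pairMat 1 ((-1 : GL (Fin n) F)⁻¹).val := rfl
    simp [symp, trE, dualCol, hb, inL, inLdual, dotProduct, Matrix.mulVec, pairMat, conj,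
      Prod.fst_sum, Prod.snd_sum, Matrix.one_apply]
  have h1 : (fun i => ((z ᵥ* h.val.val) i).1) = (fun i => (z i).1) ᵥ* (fstGL h.val).val := by
    funext i
    simp [Matrix.vecMul, dotProduct, fstGL, Prod.fst_sum]
  have h2 : (fun i => ((z ᵥ* h.val.val) i).2) = (fun i => (z i).2) ᵥ* (sndGL h.val).val := by
    funext i
    simp [Matrix.vecMul, dotProduct, sndGL, Prod.snd_sum]
  have h3 : (fstGL h.val).val * (sndGL h.val).valᵀ = 1 := by
    have hh : star' h.val.val * (betaSplit F n).val * h.val.val = (betaSplit F n).val := h.2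
    have hs : star' h.val.val = pairMat (sndGL h.val).valᵀ (fstGL h.val).valᵀ := by
      ext i j <;> simp [star', pairMat, conj, fstGL, sndGL]
    have hp : h.val.val = pairMat (fstGL h.val).val (sndGL h.val).val := by
      ext i j <;> simp [pairMat, fstGL, sndGL]
    have hb : (betaSplit F n).val = pairMat 1 (-1) := rfl
    rw [hs, hp, hb, pairMat_mul, pairMat_mul] at hh
    have h4 : (sndGL h.val).valᵀ * (fstGL h.val).val = 1 := by
      ext i j
      have := congrArg Prod.fst (congrFun (congrFun hh i) j)
      simpa [pairMat] using this
    exact mul_eq_one_comm.mp h4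
  have h5 : ∀ u v : Fin n → F,
      (u ᵥ* (fstGL h.val).val) ⬝ᵥ (v ᵥ* (sndGL h.val).val) = u ⬝ᵥ v := by
    intro u v
    rw [← Matrix.mulVec_transpose (sndGL h.val).val, Matrix.dotProduct_mulVec,
      Matrix.vecMul_vecMul, h3, Matrix.vecMul_one]
  funext w
  simp only [heisenberg, weil, hsymp, h1, h2, ← Matrix.smul_vecMul, ← Matrix.add_vecMul, h5]
  ring

end Integrals

end

end SplitTransfer

/-!
Over `E = F × F` everything splits. Write `γ = (γ₁, γ₂)`, `ζ = (ζ₁, ζ₂)`, `z = (z₁, z₂)` and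
`y = (y₁, -y₁)`. If `(h, h')` carries `[γ̄γ, x, y]` to `[β⁻¹ζ^*βζ, z, β⁻¹z^*]`, compatibility gives
`ζ₁ = h⁻¹ γ₁ h`, and the first component `ᵗζ₂ ζ₁ = h⁻¹ γ₂ γ₁ h` of the equality of norms then gives
`ᵗζ₂ = h⁻¹ γ₂ h`; moreover `z₁ = x h` and `y₁ = h z₂`. So the matching is realized by the single
element `h ∈ GL_n(F)` (`Matches.exists_conj`).

The orbital integral on the linear side runs over pairs in `GL_n(F) × GL_n(F)`, the one on the
unitary side over pairs of elements `(a, ᵗa⁻¹)`, `(b, ᵗb⁻¹)`. At `(h a, h b)` the first integrand is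
`ζ_E(1)⁻¹` times the second integrand at `(a, b)` (`integrandGL_pairGL`): the test functions have
the same arguments there, and both partial Fourier transforms become the integral `fourierPair`,
by linear substitutions of `F_n` that scale Haar measure by the absolute value of the determinant
(`modulus_det_smul_map_matAct`, proved with diagonal matrices and transvections). Since `μ` is
trivial on `F^×`, the characters `μ(det h a, det h b)` and `μ(det b⁻¹a, 1)` agree.

It remains to compare measures. The measure of `GL_n(E)` is a product of left invariant measures
of the factors (`map_pairGL_detMeasure_prod`, `map_mul_left_detMeasure`). Relative to the self-dual
measure `dx` of `F`, the self-dual measure of `E` is `|2|⁻¹ dx dx` and that of `𝔲` is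
`c ∏ dx_{ij}` with `c² = |2|^{n²}`; evaluating Fourier inversion at `0` on a product of bump
functions shows this (`measureE_eq_smul`, `exists_lieMeasure_eq_smul`). With the factor
`|2|^{-n²}` that comes from the Cayley transform, `U × U` and `GL_n(E)` both get the constant
`|2|^{-n²}`, up to `ζ_E(1)`. Hence the integrals and the integrability conditions agree.
Finally `det(x; xξ; …; xξ^{n-1})` lies in the diagonal `F^×`, so that the transfer factor is `1`
(`transferFactor_eq_one`).
-/

namespace SplitTransfer

/-! ### The normalized absolute value -/

section Modulus

open scoped Pointwise

variable {R : Type*} [CommRing R] [TopologicalSpace R] [IsTopologicalRing R]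
  [LocallyCompactSpace R]

lemma modulus_unit (u : Rˣ) : modulus (u : R) = distribHaarChar R u := by
  rw [modulus, dif_pos u.isUnit]
  congr 1
  ext
  simp

lemma modulus_of_not_isUnit {a : R} (ha : ¬IsUnit a) : modulus a = 0 := dif_neg ha

lemma modulus_pos {a : R} (ha : IsUnit a) : 0 < modulus a := by
  obtain ⟨u, rfl⟩ := ha
  rw [modulus_unit]
  exact distribHaarChar_pos

lemma modulus_one : modulus (1 : R) = 1 := by
  rw [← Units.val_one, modulus_unit, map_one]

lemma modulus_mul (a b : R) : modulus (a * b) = modulus a * modulus b := by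
  by_cases ha : IsUnit a
  · by_cases hb : IsUnit b
    · obtain ⟨u, rfl⟩ := ha
      obtain ⟨v, rfl⟩ := hb
      rw [← Units.val_mul, modulus_unit, modulus_unit, modulus_unit, map_mul]
    · rw [modulus_of_not_isUnit hb, modulus_of_not_isUnit, mul_zero]
      exact fun h => hb (isUnit_of_mul_isUnit_right h)
  · rw [modulus_of_not_isUnit ha, modulus_of_not_isUnit, zero_mul]
    exact fun h => ha (isUnit_of_mul_isUnit_left h)

lemma modulus_prod {ι : Type*} (s : Finset ι) (D : ι → R) :
    modulus (∏ i ∈ s, D i) = ∏ i ∈ s, modulus (D i) := by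
  classical
  induction s using Finset.induction_on with
  | empty => simp [modulus_one]
  | insert i s hi ih => rw [Finset.prod_insert hi, Finset.prod_insert hi, modulus_mul, ih]

/-- Multiplication by a unit `a` scales additive Haar measures by `|a|`. -/
lemma modulus_smul_map_mul [MeasurableSpace R] [BorelSpace R] (ν : Measure R)
    [ν.IsAddHaarMeasure] [ν.Regular] {a : R} (ha : IsUnit a) :
    modulus a • ν.map (a * ·) = ν := by
  obtain ⟨u, rfl⟩ := ha
  ext s hs
  have hm : Measurable fun x : R => (u : R) * x := (continuous_const_mul _).measurable
  have hpre : (fun x : R => (u : R) * x) ⁻¹' s = u⁻¹ • s := by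
    ext x
    rw [Set.mem_inv_smul_set_iff]
    rfl
  rw [Measure.smul_apply, Measure.map_apply hm hs, hpre, modulus_unit,
    ← distribHaarChar_mul ν u⁻¹ s, map_inv, ENNReal.smul_def, smul_eq_mul, ← mul_assoc,
    ← ENNReal.coe_mul, mul_inv_cancel₀ distribHaarChar_pos.ne', ENNReal.coe_one, one_mul]

end Modulus

section Field

open scoped Pointwise

variable {F : Type*} [NontriviallyNormedField F] [ProperSpace F]

/-- The normalized absolute value of a field is a function of the norm: it compares the volume
of a closed ball with that of the unit ball. -/
lemma modulus_eq_div [MeasurableSpace F] [BorelSpace F] (ν : Measure F)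
    [ν.IsAddHaarMeasure] (a : F) (ha : a ≠ 0) :
    (modulus a : ℝ≥0∞) = ν (Metric.closedBall 0 ‖a‖) / ν (Metric.closedBall 0 1) := by
  have hu : modulus a = distribHaarChar F (Units.mk0 a ha) := by
    rw [← modulus_unit, Units.val_mk0]
  have hb : (Units.mk0 a ha) • Metric.closedBall (0 : F) 1 = Metric.closedBall 0 ‖a‖ := by
    change a • Metric.closedBall (0 : F) 1 = _
    rw [smul_closedBall' ha, smul_zero, mul_one]
  rw [hu, distribHaarChar_eq_div (μ := ν) (s := Metric.closedBall 0 1), hb]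
  · exact (Metric.measure_closedBall_pos ν 0 one_pos).ne'
  · exact (isCompact_closedBall (0 : F) 1).measure_lt_top.ne

lemma measurable_modulus [MeasurableSpace F] [BorelSpace F] :
    Measurable (modulus : F → ℝ≥0) := by
  classical
  let ν : Measure F := Measure.addHaar
  have h1 : Measurable fun r : ℝ => ν (Metric.closedBall (0 : F) r) :=
    Monotone.measurable fun r s h => measure_mono (Metric.closedBall_subset_closedBall h)
  have h2 : Measurable fun a : F => if a = 0 then (0 : ℝ≥0∞) else
      ν (Metric.closedBall 0 ‖a‖) / ν (Metric.closedBall 0 1) :=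
    Measurable.ite (measurableSet_singleton 0) measurable_const
      ((h1.comp measurable_norm).div_const _)
  have h3 : (fun a : F => (modulus a : ℝ≥0∞)) = fun a : F => if a = 0 then (0 : ℝ≥0∞) else
      ν (Metric.closedBall 0 ‖a‖) / ν (Metric.closedBall 0 1) := by
    funext a
    split_ifs with h
    · rw [h, modulus_of_not_isUnit not_isUnit_zero, ENNReal.coe_zero]
    · exact modulus_eq_div ν a h
  rw [← h3] at h2
  simpa using h2.ennreal_toNNReal

/-- The absolute value of `E = F × F` is the product of the absolute values of the two factors. -/
lemma modulus_split (a b : F) : modulus ((a, b) : F × F) = modulus a * modulus b := by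
  borelize F
  by_cases h : IsUnit a ∧ IsUnit b
  · obtain ⟨⟨u, rfl⟩, ⟨v, rfl⟩⟩ := h
    have h1 : ((u : F), (v : F)) = ((MulEquiv.prodUnits.symm (u, v) : (F × F)ˣ) : F × F) := rfl
    let ν : Measure F := Measure.addHaar
    let B : Set F := Metric.closedBall 0 1
    have hB0 : ν B ≠ 0 := (Metric.measure_closedBall_pos ν 0 one_pos).ne'
    have hB1 : ν B ≠ ⊤ := (isCompact_closedBall (0 : F) 1).measure_lt_top.ne
    rw [h1, modulus_unit, modulus_unit, modulus_unit]
    refine distribHaarChar_eq_of_measure_smul_eq_mul (μ := ν.prod ν) (s := B ×ˢ B) ?_ ?_ ?_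
    · rw [Measure.prod_prod]; exact mul_ne_zero hB0 hB0
    · rw [Measure.prod_prod]; exact ENNReal.mul_ne_top hB1 hB1
    · have hs : (MulEquiv.prodUnits.symm (u, v) : (F × F)ˣ) • (B ×ˢ B)
          = (u • B) ×ˢ (v • B) := by
        ext x
        simp only [Set.mem_prod, Set.mem_smul_set_iff_inv_smul_mem]
        rfl
      rw [hs, Measure.prod_prod, Measure.prod_prod, ← distribHaarChar_mul ν,
        ← distribHaarChar_mul ν, ENNReal.coe_mul]
      ring
  · rw [modulus_of_not_isUnit (a := ((a, b) : F × F)) (by rwa [Prod.isUnit_iff])]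
    rcases not_and_or.mp h with h | h <;> rw [modulus_of_not_isUnit h] <;> simp

end Field

/-! ### Linear changes of variables -/

section LinearChange

variable {F : Type*} [NontriviallyNormedField F] [ProperSpace F]
  {V : Type*} [AddCommGroup V] [Module F V] [MeasurableSpace V] [MeasurableAdd₂ V]
  [MeasurableConstSMul F V] {ι : Type*} [Fintype ι] [DecidableEq ι]

/-- The action of an `ι × ι` matrix over `F` on `V^ι`. For `V = F` these are column vectors, for
`V = F^n` it is left multiplication on matrices, given by their rows. -/
def matAct (M : Matrix ι ι F) (A : ι → V) : ι → V := fun i => ∑ k, M i k • A k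

omit [ProperSpace F] [DecidableEq ι] in
lemma measurable_matAct (M : Matrix ι ι F) : Measurable (matAct M : (ι → V) → ι → V) := by
  refine measurable_pi_lambda _ fun i => ?_
  exact Finset.measurable_fun_sum _ fun k _ => (measurable_pi_apply k).const_smul (M i k)

omit [ProperSpace F] [MeasurableSpace V] [MeasurableAdd₂ V] [MeasurableConstSMul F V]
  [DecidableEq ι] in
lemma matAct_mul (M N : Matrix ι ι F) (A : ι → V) :
    matAct (M * N) A = matAct M (matAct N A) := by
  funext i
  simp only [matAct, Matrix.mul_apply, Finset.sum_smul, Finset.smul_sum, mul_smul]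
  exact Finset.sum_comm

/-- If scalars `c` scale the measure of `V` by `|c|^m`, then matrices `M` scale the product
measure of `V^ι` by `|det M|^m`. As in the real case, it is enough to consider diagonal
matrices and transvections. -/
lemma modulus_det_smul_map_matAct (ν : Measure V) [SigmaFinite ν] [ν.IsAddRightInvariant] (m : ℕ)
    (hν : ∀ c : F, c ≠ 0 → (modulus c ^ m) • ν.map (c • ·) = ν) (M : Matrix ι ι F)
    (hM : M.det ≠ 0) :
    (modulus M.det ^ m) • (Measure.pi fun _ : ι => ν).map (matAct M) =
      Measure.pi fun _ : ι => ν := by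
  refine diagonal_transvection_induction_of_det_ne_zero
    (fun M => (modulus M.det ^ m) • (Measure.pi fun _ : ι => ν).map (matAct M) =
      Measure.pi fun _ : ι => ν) M hM ?_ ?_ ?_
  · intro D hD
    have hD' : ∀ i, D i ≠ 0 := fun i => by
      rw [det_diagonal] at hD
      exact Finset.prod_ne_zero_iff.1 hD i (Finset.mem_univ i)
    refine (Measure.pi_eq fun s hs => ?_).symm
    have hpre : (matAct (diagonal D) : (ι → V) → ι → V) ⁻¹' Set.pi Set.univ s =
        Set.pi Set.univ fun i => (fun v : V => D i • v) ⁻¹' s i := by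
      ext A
      simp [matAct, diagonal_apply]
    rw [Measure.smul_apply, Measure.map_apply (measurable_matAct _)
      (MeasurableSet.univ_pi hs), hpre, Measure.pi_pi, det_diagonal, modulus_prod,
      ← Finset.prod_pow, ENNReal.smul_def, smul_eq_mul, ENNReal.ofNNReal_finsetProd,
      ← Finset.prod_mul_distrib]
    refine Finset.prod_congr rfl fun i _ => ?_
    conv_rhs => rw [← hν (D i) (hD' i)]
    rw [Measure.smul_apply, Measure.map_apply (measurable_const_smul (D i)) (hs i)]
    rfl
  · intro t
    rw [TransvectionStruct.det, modulus_one, one_pow, one_smul]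
    have ht := measurable_matAct (V := V) t.toMatrix
    refine (Measure.pi_eq fun s hs => ?_).symm
    have h2s : MeasurableSet (Set.univ.pi s) := .univ_pi hs
    simp_rw [← Measure.pi_pi, ← lintegral_indicator_one h2s]
    rw [lintegral_map (measurable_one.indicator h2s) ht]
    -- in the coordinate that it changes, a transvection is a translation
    refine lintegral_eq_of_lmarginal_eq {t.i} ((measurable_one.indicator h2s).comp ht)
      (measurable_one.indicator h2s) ?_
    simp_rw [lmarginal_singleton]
    ext A
    obtain ⟨i, k, hik, c⟩ := t
    have hact : ∀ v : V, matAct (transvection i k c) (Function.update A i v) =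
        Function.update A i (v + c • A k) := by
      intro v
      funext l
      have hsum : ∀ x : ι → V, ∑ p, (transvection i k c) l p • x p =
          x l + if i = l then c • x k else 0 := by
        intro x
        simp [transvection, add_smul, Finset.sum_add_distrib, Matrix.one_apply, Matrix.single_apply,
          ite_and]
      rw [matAct, hsum]
      by_cases hl : i = l
      · subst hl
        simp [hik.symm]
      · simp [hl, Function.update_of_ne (Ne.symm hl)]
    simp only [TransvectionStruct.toMatrix_mk, hact]
    exact lintegral_add_right_eq_self
      (fun v => Set.indicator (Set.univ.pi s) 1 (Function.update A i v)) (c • A k)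
  · intro A B hA hB IHA IHB
    have hc : (matAct (A * B) : (ι → V) → ι → V) = matAct A ∘ matAct B :=
      funext fun x => matAct_mul A B x
    rw [det_mul, modulus_mul, mul_pow, hc,
      ← Measure.map_map (measurable_matAct A) (measurable_matAct B), mul_smul,
      ← Measure.map_smul, IHB, IHA]

end LinearChange

/-! ### Measures on general linear groups -/

section Entries

variable {n : ℕ} {R : Type*} [NormedCommRing R] [CompleteSpace R]

lemma isOpenEmbedding_entries :
    Topology.IsOpenEmbedding (entries : GL (Fin n) R → Fin n → Fin n → R) := by
  let _ : NormedRing (Matrix (Fin n) (Fin n) R) := Matrix.linftyOpNormedRing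
  -- the underlying uniform structure of this norm is that of the product `R^{n × n}`
  have hc : CompleteSpace (Fin n → Fin n → R) := inferInstance
  have h : @CompleteSpace (Matrix (Fin n) (Fin n) R) PseudoMetricSpace.toUniformSpace := hc
  have : HasSummableGeomSeries (Matrix (Fin n) (Fin n) R) :=
    @instHasSummableGeomSeriesOfCompleteSpace _ _ h
  exact Units.isOpenEmbedding_val (R := Matrix (Fin n) (Fin n) R)

lemma measurableEmbedding_entries [SecondCountableTopology R] [MeasurableSpace R] [BorelSpace R] :
    MeasurableEmbedding (entries : GL (Fin n) R → Fin n → Fin n → R) :=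
  isOpenEmbedding_entries.measurableEmbedding

instance [SecondCountableTopology R] : SecondCountableTopology (GL (Fin n) R) :=
  isOpenEmbedding_entries.isEmbedding.secondCountableTopology

end Entries

section DetDensity

variable {n : ℕ} {R : Type*} [CommRing R] [TopologicalSpace R] [IsTopologicalRing R]
  [LocallyCompactSpace R]

/-- The density `|det A|^{-n}` of the measure of `GL_n(R)` on the space of matrices. -/
noncomputable def detDensity (A : Fin n → Fin n → R) : ℝ≥0∞ :=
  ((modulus (Matrix.of A).det ^ n)⁻¹ : ℝ≥0)

lemma measurable_detDensity [SecondCountableTopology R] [MeasurableSpace R] [BorelSpace R]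
    (h : Measurable (modulus : R → ℝ≥0)) :
    Measurable (detDensity : (Fin n → Fin n → R) → ℝ≥0∞) := by
  have hdet : Continuous fun A : Fin n → Fin n → R => (Matrix.of A).det :=
    Continuous.matrix_det (A := fun A : Fin n → Fin n → R => Matrix.of A) continuous_id
  exact ((h.comp hdet.measurable).pow_const n).inv.coe_nnreal_ennreal

end DetDensity

lemma map_entries_detMeasure {n : ℕ} {R : Type*} [NormedCommRing R] [ProperSpace R]
    [CompleteSpace R] [SecondCountableTopology R] [MeasurableSpace R] [BorelSpace R]
    (ν : Measure (Fin n → Fin n → R)) :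
    (detMeasure ν).map entries = (ν.withDensity detDensity).restrict (Set.range entries) :=
  measurableEmbedding_entries.map_comap _

lemma eq_of_map_entries_eq {n : ℕ} {R : Type*} [NormedCommRing R] [CompleteSpace R]
    [SecondCountableTopology R] [MeasurableSpace R] [BorelSpace R]
    {μ ν : Measure (GL (Fin n) R)} (h : μ.map entries = ν.map entries) : μ = ν := by
  rw [← measurableEmbedding_entries.comap_map μ, h, measurableEmbedding_entries.comap_map]

lemma mem_range_entries {n : ℕ} {R : Type*} [CommRing R] {A : Fin n → Fin n → R} :
    A ∈ Set.range (entries : GL (Fin n) R → Fin n → Fin n → R) ↔ IsUnit (Matrix.of A).det := by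
  rw [← Matrix.isUnit_iff_isUnit_det]
  exact Iff.rfl

section Factors

variable {n : ℕ} {F : Type*} [Field F]

lemma fstGL_pairGL (g h : GL (Fin n) F) : fstGL (pairGL g h) = g := by
  ext i k
  rfl

lemma sndGL_pairGL (g h : GL (Fin n) F) : sndGL (pairGL g h) = h := by
  ext i k
  rfl

end Factors

section Continuity

variable {n : ℕ} {F : Type*} [NontriviallyNormedField F] [CompleteSpace F]

lemma continuous_fstGL : Continuous (fstGL : GL (Fin n) (F × F) → GL (Fin n) F) := by
  rw [isOpenEmbedding_entries.isEmbedding.continuous_iff]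
  exact continuous_pi fun i => continuous_pi fun k => continuous_fst.comp
    ((continuous_apply k).comp
      ((continuous_apply i).comp isOpenEmbedding_entries.isEmbedding.continuous))

lemma continuous_sndGL : Continuous (sndGL : GL (Fin n) (F × F) → GL (Fin n) F) := by
  rw [isOpenEmbedding_entries.isEmbedding.continuous_iff]
  exact continuous_pi fun i => continuous_pi fun k => continuous_snd.comp
    ((continuous_apply k).comp
      ((continuous_apply i).comp isOpenEmbedding_entries.isEmbedding.continuous))

lemma continuous_pairGL :
    Continuous fun p : GL (Fin n) F × GL (Fin n) F => pairGL p.1 p.2 := by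
  rw [isOpenEmbedding_entries.isEmbedding.continuous_iff]
  have he : ∀ i k, Continuous fun g : GL (Fin n) F => entries g i k := fun i k =>
    (continuous_apply k).comp
      ((continuous_apply i).comp isOpenEmbedding_entries.isEmbedding.continuous)
  exact continuous_pi fun i => continuous_pi fun k =>
    ((he i k).comp continuous_fst).prodMk ((he i k).comp continuous_snd)

lemma continuous_transposeGL : Continuous (transposeGL : GL (Fin n) F → GL (Fin n) F) := by
  rw [isOpenEmbedding_entries.isEmbedding.continuous_iff]
  exact continuous_pi fun i => continuous_pi fun k =>
    (continuous_apply i).comp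
      ((continuous_apply k).comp isOpenEmbedding_entries.isEmbedding.continuous)

end Continuity

section PairEquiv

variable {F : Type*} [MeasurableSpace F] {n : ℕ}

/-- The pair `(A, B)` of matrices over `F` as a matrix over `E = F × F`, as a measurable
equivalence. -/
def pairEquiv (F : Type*) [MeasurableSpace F] (n : ℕ) :
    (Fin n → Fin n → F) × (Fin n → Fin n → F) ≃ᵐ (Fin n → Fin n → F × F) :=
  ((MeasurableEquiv.piCongrRight fun _ =>
      MeasurableEquiv.arrowProdEquivProdArrow F F (Fin n)).trans
    (MeasurableEquiv.arrowProdEquivProdArrow (Fin n → F) (Fin n → F) (Fin n))).symm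

lemma measurePreserving_pairEquiv (ν : Measure F) [SigmaFinite ν] :
    MeasurePreserving (pairEquiv F n)
      ((Measure.pi fun _ : Fin n => Measure.pi fun _ : Fin n => ν).prod
        (Measure.pi fun _ : Fin n => Measure.pi fun _ : Fin n => ν))
      (Measure.pi fun _ : Fin n => Measure.pi fun _ : Fin n => ν.prod ν) := by
  refine MeasurePreserving.symm _ ?_
  refine (measurePreserving_arrowProdEquivProdArrow _ _ (Fin n) _ _).comp ?_
  exact measurePreserving_pi _ _ fun _ =>
    measurePreserving_arrowProdEquivProdArrow F F (Fin n) (fun _ => ν) fun _ => ν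

end PairEquiv

section Field

variable {F : Type*} [NontriviallyNormedField F] [ProperSpace F] [MeasurableSpace F]
  [BorelSpace F] {n : ℕ}

lemma measurable_modulus_split : Measurable (modulus : F × F → ℝ≥0) := by
  have h : (modulus : F × F → ℝ≥0) = fun a => modulus a.1 * modulus a.2 :=
    funext fun a => modulus_split a.1 a.2
  rw [h]
  exact (measurable_modulus.comp measurable_fst).mul (measurable_modulus.comp measurable_snd)

instance sigmaFinite_withDensity_detDensity (ν : Measure (Fin n → Fin n → F)) [SigmaFinite ν] :
    SigmaFinite (ν.withDensity detDensity) :=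
  SigmaFinite.withDensity_of_ne_top (Filter.Eventually.of_forall fun _ => ENNReal.coe_ne_top)

instance sigmaFinite_detMeasure (ν : Measure (Fin n → Fin n → F)) [SigmaFinite ν] :
    SigmaFinite (detMeasure ν) := by
  refine SigmaFinite.of_map _ measurableEmbedding_entries.measurable.aemeasurable ?_
  rw [map_entries_detMeasure]
  infer_instance

lemma modulus_pow_smul_map_smul (dx : Measure F) [dx.IsAddHaarMeasure] {c : F} (hc : c ≠ 0) :
    (modulus c ^ n) • (Measure.pi fun _ : Fin n => dx).map (c • ·) =
      Measure.pi fun _ : Fin n => dx := by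
  have key := modulus_det_smul_map_matAct (F := F) (ι := Fin n) dx 1 (fun c hc => by
    rw [pow_one]; exact modulus_smul_map_mul dx (isUnit_iff_ne_zero.mpr hc))
    (diagonal fun _ => c) (by simp [det_diagonal, hc])
  have he : (matAct (diagonal fun _ => c) : (Fin n → F) → Fin n → F) = (c • ·) := by
    funext w i
    simp [matAct, diagonal_apply]
  have hmod : modulus (c ^ n) = modulus c ^ n := by
    simpa using modulus_prod Finset.univ fun _ : Fin n => c
  rwa [pow_one, he, det_diagonal, Finset.prod_const, Finset.card_univ, Fintype.card_fin,
    hmod] at key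

/-- Invertible matrices scale Haar measure on row vectors by the absolute value of their
determinant. -/
lemma modulus_det_smul_map_vecMul (dx : Measure F) [dx.IsAddHaarMeasure]
    (h : GL (Fin n) F) :
    modulus h.val.det • (Measure.pi fun _ : Fin n => dx).map (· ᵥ* h.val) =
      Measure.pi fun _ : Fin n => dx := by
  have hd : h.valᵀ.det ≠ 0 := by
    rw [det_transpose]
    exact (GeneralLinearGroup.det h).ne_zero
  have key := modulus_det_smul_map_matAct (F := F) dx 1 (fun c hc => by
    rw [pow_one]; exact modulus_smul_map_mul dx (isUnit_iff_ne_zero.mpr hc)) h.valᵀ hd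
  have he : (matAct h.valᵀ : (Fin n → F) → Fin n → F) = (· ᵥ* h.val) := by
    funext w i
    simp [matAct, Matrix.vecMul, dotProduct, mul_comm]
  rwa [pow_one, det_transpose, he] at key

/-- The measure `|det g|^{-n} ∏ dx_{ij}` on `GL_n(F)` is left invariant. -/
lemma map_mul_left_detMeasure (dx : Measure F) [dx.IsAddHaarMeasure] (h : GL (Fin n) F) :
    (detMeasure (Measure.pi fun _ : Fin n => Measure.pi fun _ : Fin n => dx)).map (h * ·) =
      detMeasure (Measure.pi fun _ : Fin n => Measure.pi fun _ : Fin n => dx) := by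
  have hu : h.val.det ≠ 0 := (GeneralLinearGroup.det h).ne_zero
  have hrow : ∀ c : F, c ≠ 0 → (modulus c ^ n) • (Measure.pi fun _ : Fin n => dx).map (c • ·) =
      Measure.pi fun _ : Fin n => dx := fun c hc => modulus_pow_smul_map_smul dx hc
  have hM := modulus_det_smul_map_matAct (Measure.pi fun _ : Fin n => dx) n hrow h.val hu
  set M : Measure (Fin n → Fin n → F) := Measure.pi fun _ : Fin n => Measure.pi fun _ : Fin n => dx
  set c : ℝ≥0 := modulus h.val.det ^ n with hc
  have hc0 : c ≠ 0 := pow_ne_zero _ (modulus_pos (isUnit_iff_ne_zero.mpr hu)).ne'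
  set L : (Fin n → Fin n → F) → Fin n → Fin n → F := matAct h.val with hL
  have hLm : Measurable L := measurable_matAct h.val
  have hof : ∀ A : Fin n → Fin n → F, Matrix.of (L A) = h.val * Matrix.of A := by
    intro A
    ext i k
    simp [hL, matAct, Matrix.mul_apply]
  have hdens : ∀ A, detDensity A = c * detDensity (L A) := by
    intro A
    rw [detDensity, detDensity, hof, det_mul, modulus_mul, mul_pow, mul_inv, ← ENNReal.coe_mul,
      ← mul_assoc, ← hc, mul_inv_cancel₀ hc0, one_mul]
  have hrange : L ⁻¹' Set.range (entries : GL (Fin n) F → _) = Set.range entries := by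
    ext A
    rw [Set.mem_preimage, mem_range_entries, mem_range_entries, hof, det_mul, IsUnit.mul_iff]
    exact and_iff_right (isUnit_iff_ne_zero.mpr hu)
  have hrm : MeasurableSet (Set.range (entries : GL (Fin n) F → _)) :=
    measurableEmbedding_entries.measurableSet_range
  have hmul : Measurable fun g : GL (Fin n) F => h * g := (continuous_const_mul h).measurable
  have hcomp : entries ∘ (fun g : GL (Fin n) F => h * g) = L ∘ entries := by
    funext g i k
    simp [hL, matAct, entries, Matrix.mul_apply]
  apply eq_of_map_entries_eq
  rw [Measure.map_map measurableEmbedding_entries.measurable hmul, hcomp,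
    ← Measure.map_map hLm measurableEmbedding_entries.measurable, map_entries_detMeasure]
  ext s hs
  rw [Measure.map_apply hLm hs, Measure.restrict_apply (hLm hs), Measure.restrict_apply hs,
    withDensity_apply _ ((hLm hs).inter hrm), withDensity_apply _ (hs.inter hrm)]
  have hdm := measurable_detDensity (n := n) (measurable_modulus (F := F))
  -- on matrices, `|det h|^n` from the change of variables cancels `|det h|^{-n}` from the density
  conv_rhs => rw [← hM]
  rw [Measure.restrict_smul, ENNReal.smul_def, lintegral_smul_measure,
    setLIntegral_map (hs.inter hrm) hdm hLm, Set.preimage_inter, hrange, smul_eq_mul,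
    ← lintegral_const_mul _ (f := fun A => detDensity (L A)) (hdm.comp hLm)]
  exact lintegral_congr fun A => hdens A

omit [MeasurableSpace F] [BorelSpace F] in
lemma measurableEmbedding_pairGL :
    MeasurableEmbedding fun p : GL (Fin n) F × GL (Fin n) F => pairGL p.1 p.2 := by
  have hl : Function.LeftInverse (fun g : GL (Fin n) (F × F) => (fstGL g, sndGL g))
      fun p : GL (Fin n) F × GL (Fin n) F => pairGL p.1 p.2 := fun p =>
    Prod.ext (fstGL_pairGL _ _) (sndGL_pairGL _ _)
  have : T2Space (GL (Fin n) (F × F)) := isOpenEmbedding_entries.isEmbedding.t2Space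
  exact (hl.isClosedEmbedding (continuous_fstGL.prodMk continuous_sndGL)
    continuous_pairGL).measurableEmbedding

omit [MeasurableSpace F] [BorelSpace F] in
lemma measurableEmbedding_toUnitary :
    MeasurableEmbedding (toUnitary : GL (Fin n) F → unitaryGroup (betaSplit F n)) := by
  have hl : Function.LeftInverse (fun u : unitaryGroup (betaSplit F n) => fstGL u.val)
      (toUnitary : GL (Fin n) F → _) := fun g => fstGL_pairGL _ _
  have : T2Space (GL (Fin n) (F × F)) := isOpenEmbedding_entries.isEmbedding.t2Space
  refine (hl.isClosedEmbedding (continuous_fstGL.comp continuous_subtype_val)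
    ?_).measurableEmbedding
  exact (continuous_pairGL.comp (continuous_id.prodMk
    (continuous_transposeGL.comp continuous_inv))).subtype_mk _

omit [ProperSpace F] [BorelSpace F] in
lemma det_pairEquiv (p : (Fin n → Fin n → F) × (Fin n → Fin n → F)) :
    (Matrix.of (pairEquiv F n p)).det = ((Matrix.of p.1).det, (Matrix.of p.2).det) :=
  Prod.ext (RingHom.map_det (RingHom.fst F F) _) (RingHom.map_det (RingHom.snd F F) _)

omit [BorelSpace F] in
lemma detDensity_pairEquiv (p : (Fin n → Fin n → F) × (Fin n → Fin n → F)) :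
    detDensity (pairEquiv F n p) = detDensity p.1 * detDensity p.2 := by
  rw [detDensity, det_pairEquiv, modulus_split, mul_pow, mul_inv, ENNReal.coe_mul]
  rfl

omit [ProperSpace F] [BorelSpace F] in
lemma pairEquiv_preimage_range_entries :
    pairEquiv F n ⁻¹' Set.range (entries : GL (Fin n) (F × F) → _) =
      Set.range (entries : GL (Fin n) F → _) ×ˢ Set.range (entries : GL (Fin n) F → _) := by
  ext p
  rw [Set.mem_preimage, mem_range_entries, det_pairEquiv, Prod.isUnit_iff, Set.mem_prod,
    mem_range_entries, mem_range_entries]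

/-- On `Mat_n(E) = Mat_n(F) × Mat_n(F)`, the measure `|det A|_E^{-n} ∏ dx_{ij}` on the invertible
matrices is the product of the corresponding measures of the two factors. -/
lemma map_pairEquiv_withDensity_restrict (dx : Measure F) [SigmaFinite dx] :
    ((((Measure.pi fun _ : Fin n => Measure.pi fun _ : Fin n => dx).prod
      (Measure.pi fun _ : Fin n => Measure.pi fun _ : Fin n => dx)).withDensity
        fun p => detDensity p.1 * detDensity p.2).restrict
          (Set.range (entries : GL (Fin n) F → _) ×ˢ Set.range (entries : GL (Fin n) F → _))).map
            (pairEquiv F n) =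
      ((Measure.pi fun _ : Fin n => Measure.pi fun _ : Fin n => dx.prod dx).withDensity
        detDensity).restrict (Set.range (entries : GL (Fin n) (F × F) → _)) := by
  have hΦ := measurePreserving_pairEquiv (n := n) dx
  have hdmE := measurable_detDensity (n := n) (measurable_modulus_split (F := F))
  have hrm : MeasurableSet (Set.range (entries : GL (Fin n) (F × F) → _)) :=
    measurableEmbedding_entries.measurableSet_range
  ext s hs
  rw [Measure.map_apply (pairEquiv F n).measurable hs,
    Measure.restrict_apply ((pairEquiv F n).measurable hs), Measure.restrict_apply hs,
    withDensity_apply _ (hs.inter hrm), ← pairEquiv_preimage_range_entries, ← Set.preimage_inter,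
    withDensity_apply _ ((pairEquiv F n).measurable (hs.inter hrm)), ← hΦ.map_eq,
    setLIntegral_map (hs.inter hrm) hdmE (pairEquiv F n).measurable]
  exact lintegral_congr fun p => (detDensity_pairEquiv p).symm

lemma map_entries_detMeasure_prod (M : Measure (Fin n → Fin n → F)) [SigmaFinite M] :
    ((detMeasure M).prod (detMeasure M)).map (Prod.map entries entries) =
      ((M.prod M).withDensity fun p => detDensity p.1 * detDensity p.2).restrict
        (Set.range (entries : GL (Fin n) F → _) ×ˢ Set.range (entries : GL (Fin n) F → _)) := by
  have hdm := measurable_detDensity (n := n) (measurable_modulus (F := F))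
  have he := measurableEmbedding_entries (n := n) (R := F)
  rw [← Measure.map_prod_map _ _ he.measurable he.measurable, map_entries_detMeasure,
    Measure.prod_restrict, prod_withDensity hdm hdm]

/-- Under the identification `GL_n(E) = GL_n(F) × GL_n(F)`, the measure `|det g|_E^{-n} ∏ dx_{ij}`
is the product of the corresponding measures of the two factors. -/
lemma map_pairGL_detMeasure_prod (dx : Measure F) [SigmaFinite dx] :
    ((detMeasure (Measure.pi fun _ : Fin n => Measure.pi fun _ : Fin n => dx)).prod
      (detMeasure (Measure.pi fun _ : Fin n => Measure.pi fun _ : Fin n => dx))).map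
        (fun p => pairGL p.1 p.2) =
      detMeasure (Measure.pi fun _ : Fin n => Measure.pi fun _ : Fin n => dx.prod dx) := by
  have he := measurableEmbedding_entries (n := n) (R := F)
  have hcomp : entries ∘ (fun p : GL (Fin n) F × GL (Fin n) F => pairGL p.1 p.2) =
      pairEquiv F n ∘ Prod.map entries entries := rfl
  have h := map_pairEquiv_withDensity_restrict (n := n) dx
  rw [← map_entries_detMeasure_prod, ← map_entries_detMeasure,
    Measure.map_map (pairEquiv F n).measurable (he.measurable.prodMap he.measurable), ← hcomp] at h
  apply eq_of_map_entries_eq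
  rw [← h]
  exact Measure.map_map measurableEmbedding_entries.measurable
      measurableEmbedding_pairGL.measurable

end Field

/-! ### Test functions -/

section TestFunctions

variable {F : Type*} [NontriviallyNormedField F]

lemma IsSmooth.isSchwartz {V : Type*} [NormedAddCommGroup V] [NormedSpace F V] {f : V → ℂ}
    (hf : IsSmooth F f) (hc : HasCompactSupport f) : IsSchwartz F f := by
  rcases hf with ⟨hu, hl⟩ | ⟨i, hi⟩
  · exact Or.inl ⟨hu, hl, hc⟩
  · let _ : NormedSpace ℝ V := NormedSpace.restrictScalars ℝ F V
    exact Or.inr ⟨i, hc.toSchwartzMap hi, rfl⟩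

/-- A product of smooth functions of linear forms is smooth. -/
lemma IsSmooth.prod_comp {V : Type*} [NormedAddCommGroup V] [NormedSpace F V] {φ : F → ℂ}
    (hφ : IsSmooth F φ) {ι : Type*} [Fintype ι] (l : ι → V →L[F] F) :
    IsSmooth F fun v => ∏ i, φ (l i v) := by
  rcases hφ with ⟨hu, hl⟩ | ⟨i, hi⟩
  · refine Or.inl ⟨hu, ?_⟩
    have h : (fun v => ∏ i, φ (l i v)) = ∏ i, φ ∘ l i := by
      funext v
      simp
    rw [h]
    refine Finset.prod_induction _ IsLocallyConstant (fun a b ha hb => ha.mul hb)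
      (IsLocallyConstant.const 1) fun i _ => hl.comp_continuous (l i).continuous
  · refine Or.inr ⟨i, ?_⟩
    let _ : NormedSpace ℝ V := NormedSpace.restrictScalars ℝ F V
    let _ : NormedSpace ℝ F := NormedSpace.restrictScalars ℝ F F
    have hl : ∀ k, ContDiff ℝ ∞ fun v => l k v := by
      intro k
      let L : V →L[ℝ] F :=
        { toFun := l k
          map_add' := map_add (l k)
          map_smul' := fun r v => (l k).map_smul (algebraMap ℝ F r) v
          cont := (l k).continuous }
      exact L.contDiff
    exact contDiff_prod fun k _ => ContDiff.comp (g := φ) hi (hl k)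

/-- A local field of characteristic zero carries a smooth function of compact support with value
`1` at `0`. -/
lemma exists_isSmooth_hasCompactSupport [ProperSpace F]
    (hF : IsUltrametricDist F ∨ Nonempty (NormedAlgebra ℝ F)) :
    ∃ φ : F → ℂ, IsSmooth F φ ∧ HasCompactSupport φ ∧ φ 0 = 1 := by
  rcases hF with hu | ⟨⟨i⟩⟩
  · have hclopen : IsClopen (Metric.closedBall (0 : F) 1) :=
      IsUltrametricDist.isClopen_closedBall 0 one_ne_zero
    refine ⟨Set.indicator (Metric.closedBall 0 1) 1, Or.inl ⟨hu, ?_⟩, ?_, ?_⟩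
    · rw [← LocallyConstant.coe_charFn ℂ hclopen]
      exact (LocallyConstant.charFn ℂ hclopen).isLocallyConstant
    · exact HasCompactSupport.intro (isCompact_closedBall (0 : F) 1) fun x hx =>
        Set.indicator_of_notMem hx _
    · simp
  · let _ : NormedSpace ℝ F := NormedSpace.restrictScalars ℝ F F
    have : FiniteDimensional ℝ F := FiniteDimensional.of_locallyCompactSpace ℝ
    let c : ContDiffBump (0 : F) := ⟨1, 2, one_pos, one_lt_two⟩
    refine ⟨fun x => ((c x : ℝ) : ℂ),
      Or.inr ⟨i, Complex.ofRealCLM.contDiff.comp c.contDiff⟩, ?_, ?_⟩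
    · exact c.hasCompactSupport.comp_left (g := Complex.ofReal) Complex.ofReal_zero
    · have : c 0 = 1 := c.one_of_mem_closedBall (Metric.mem_closedBall_self c.rIn_pos.le)
      simp [this]

end TestFunctions

/-! ### Self-dual measures -/

section SelfDual

variable {F : Type*} [NontriviallyNormedField F] [ProperSpace F] [MeasurableSpace F]
  [BorelSpace F] {n : ℕ}

lemma integral_comp_mul_left (dx : Measure F) [dx.IsAddHaarMeasure] {a : F} (ha : a ≠ 0)
    (g : F → ℂ) : ∫ y, g (a * y) ∂dx = ((modulus a : ℝ) : ℂ)⁻¹ * ∫ y, g y ∂dx := by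
  have h0 : ((modulus a : ℝ) : ℂ) ≠ 0 := by
    exact_mod_cast (modulus_pos (isUnit_iff_ne_zero.mpr ha)).ne'
  have hm : MeasurableEmbedding fun y : F => a * y :=
    (Homeomorph.mulLeft₀ a ha).measurableEmbedding
  conv_rhs => rw [← modulus_smul_map_mul dx (isUnit_iff_ne_zero.mpr ha)]
  rw [integral_smul_nnreal_measure, hm.integral_map, NNReal.smul_def, Complex.real_smul,
    ← mul_assoc, inv_mul_cancel₀ h0, one_mul]

omit [NontriviallyNormedField F] [ProperSpace F] [BorelSpace F] in
lemma integral_pi_pi_prod (dx : Measure F) [SigmaFinite dx] (g : Fin n → Fin n → F → ℂ) :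
    ∫ X : Fin n → Fin n → F, ∏ i, ∏ k, g i k (X i k)
        ∂(Measure.pi fun _ => Measure.pi fun _ => dx) =
      ∏ i, ∏ k, ∫ x, g i k x ∂dx := by
  rw [integral_fintype_prod_eq_prod (fun i (r : Fin n → F) => ∏ k, g i k (r k))]
  exact Finset.prod_congr rfl fun i _ => integral_fintype_prod_eq_prod (g i)

omit [ProperSpace F] [MeasurableSpace F] [BorelSpace F] in
lemma coe_liePairing (ψ' : AddChar F Circle) (X Y : Fin n → Fin n → F) :
    (liePairing ψ' X Y : ℂ) = ∏ i, ∏ k, (ψ' (X i k * (2 * Y k i)) : ℂ) := by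
  have h : trE (Matrix.trace (toLie X * toLie Y)) = ∑ i, ∑ k, X i k * (2 * Y k i) := by
    have hs : ∑ i, ∑ k, X k i * Y i k = ∑ i, ∑ k, X i k * Y k i := Finset.sum_comm
    have h1 : (Matrix.trace (toLie X * toLie Y)).1 = ∑ i, ∑ k, X i k * Y k i := by
      simp [toLie, pairMat, Matrix.trace, Matrix.mul_apply, Prod.fst_sum]
    have h2 : (Matrix.trace (toLie X * toLie Y)).2 = ∑ i, ∑ k, X k i * Y i k := by
      simp [toLie, pairMat, Matrix.trace, Matrix.mul_apply, Prod.snd_sum]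
    rw [trE, h1, h2, hs]
    simp only [← Finset.sum_add_distrib]
    exact Finset.sum_congr rfl fun i _ => Finset.sum_congr rfl fun k _ => by ring
  have hψ : ∀ u : Fin n → F, ((ψ' (∑ k, u k) : Circle) : ℂ) = ∏ k, (ψ' (u k) : ℂ) := by
    intro u
    have h1 : ψ' (∑ k, u k) = ∏ k, ψ' (u k) := map_prod ψ'.toMonoidHom _ _
    rw [h1]
    exact map_prod Circle.coeHom _ _
  rw [liePairing, h, hψ]
  exact Finset.prod_congr rfl fun i _ => hψ _

variable {ψ' : AddChar F Circle} {dx : Measure F}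

/-- The Fourier transform at a dilated frequency integrates to `|a|⁻¹` times the value
at `0`. -/
lemma IsSelfDual.integral_fourier_mul_left (hdx : IsSelfDual F (fun x y => ψ' (x * y)) dx)
    {φ : F → ℂ} (hφ : IsSchwartz F φ) {a : F} (ha : a ≠ 0) :
    ∫ y, ∫ x, φ x * (ψ' (x * (a * y)) : ℂ) ∂dx ∂dx = ((modulus a : ℝ) : ℂ)⁻¹ * φ 0 := by
  have := hdx.haar
  have h := hdx.inversion φ hφ 0
  simp only [mul_zero, AddChar.map_zero_eq_one, Circle.coe_one, mul_one, neg_zero] at h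
  rw [integral_comp_mul_left dx ha fun y => ∫ x, φ x * (ψ' (x * y) : ℂ) ∂dx, h]

/-- The self-dual measure on `𝔲` is `c ∏ dx_{ij}` with `c² = |2|^{n²}`, because the pairing is
`ψ'(2 tr(XY))` in the coordinates `X ∈ Mat_n(F)`. -/
lemma exists_lieMeasure_eq_smul (hF : IsUltrametricDist F ∨ Nonempty (NormedAlgebra ℝ F))
    (h2 : (2 : F) ≠ 0) (hdx : IsSelfDual F (fun x y => ψ' (x * y)) dx)
    {dX : Measure (Fin n → Fin n → F)} (hdX : IsSelfDual F (liePairing ψ') dX) :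
    ∃ c : ℝ≥0, c ^ 2 = modulus (2 : F) ^ (n ^ 2) ∧
      dX = c • Measure.pi fun _ : Fin n => Measure.pi fun _ : Fin n => dx := by
  have := hdx.haar
  have := hdX.haar
  obtain ⟨φ, hφ, hφc, hφ0⟩ := exists_isSmooth_hasCompactSupport hF
  set P : Measure (Fin n → Fin n → F) := Measure.pi fun _ => Measure.pi fun _ => dx with hP
  have hrow : (Measure.pi fun _ : Fin n => dx).IsAddHaarMeasure := inferInstance
  have hPh : P.IsAddHaarMeasure := Measure.pi.isAddHaarMeasure _
  obtain ⟨c, rfl⟩ : ∃ c : ℝ≥0, dX = c • P := ⟨_, Measure.isAddLeftInvariant_eq_smul dX P⟩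
  refine ⟨c, ?_, rfl⟩
  have hΦ : IsSchwartz F fun X : Fin n → Fin n → F => ∏ i, ∏ k, φ (X i k) := by
    have hs := hφ.prod_comp fun p : Fin n × Fin n =>
      (ContinuousLinearMap.proj p.2 : (Fin n → F) →L[F] F).comp
        (ContinuousLinearMap.proj p.1 : (Fin n → Fin n → F) →L[F] (Fin n → F))
    simp only [Fintype.prod_prod_type, ContinuousLinearMap.comp_apply,
      ContinuousLinearMap.proj_apply] at hs
    refine hs.isSchwartz (HasCompactSupport.intro (isCompact_univ_pi fun _ : Fin n =>
      isCompact_univ_pi fun _ : Fin n => hφc) fun X hX => ?_)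
    simp only [Set.mem_univ_pi, not_forall] at hX
    obtain ⟨i, k, hik⟩ := hX
    exact Finset.prod_eq_zero (Finset.mem_univ i)
      (Finset.prod_eq_zero (Finset.mem_univ k) (image_eq_zero_of_notMem_tsupport hik))
  have h := hdX.inversion _ hΦ 0
  simp only [coe_liePairing, Pi.zero_apply, mul_zero, AddChar.map_zero_eq_one, Circle.coe_one,
    Finset.prod_const_one, mul_one, neg_zero, hφ0, ← Finset.prod_mul_distrib,
    integral_smul_nnreal_measure, NNReal.smul_def, Complex.real_smul, hP] at h
  have hin : ∀ Y : Fin n → Fin n → F,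
      ∫ X : Fin n → Fin n → F, ∏ i, ∏ k, φ (X i k) * (ψ' (X i k * (2 * Y k i)) : ℂ)
        ∂(Measure.pi fun _ => Measure.pi fun _ => dx) =
      ∏ k, ∏ i, ∫ x, φ x * (ψ' (x * (2 * Y k i)) : ℂ) ∂dx := by
    intro Y
    rw [integral_pi_pi_prod dx fun i k x => φ x * (ψ' (x * (2 * Y k i)) : ℂ)]
    exact Finset.prod_comm
  simp only [hin, integral_const_mul] at h
  rw [integral_pi_pi_prod dx fun _ _ y => ∫ x, φ x * (ψ' (x * (2 * y)) : ℂ) ∂dx,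
    hdx.integral_fourier_mul_left (hφ.isSchwartz hφc) h2, hφ0] at h
  simp only [mul_one, Finset.prod_const, Finset.card_univ, Fintype.card_fin, ← pow_mul] at h
  have h0 : ((modulus (2 : F) : ℝ) : ℂ) ≠ 0 := by
    exact_mod_cast (modulus_pos (isUnit_iff_ne_zero.mpr h2)).ne'
  rw [inv_pow, ← mul_assoc, ← sq, ← sq, mul_inv_eq_one₀ (pow_ne_zero _ h0)] at h
  exact_mod_cast h

/-- The self-dual measure on `E = F × F` is `|2|⁻¹ dx dx`, because `ψ(xy)` is
`ψ'(x₁ y₁ / 2) ψ'(x₂ y₂ / 2)`. -/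
lemma measureE_eq_smul (hF : IsUltrametricDist F ∨ Nonempty (NormedAlgebra ℝ F))
    (h2 : (2 : F) ≠ 0) (hdx : IsSelfDual F (fun x y => ψ' (x * y)) dx)
    {dxE : Measure (F × F)} (hdxE : IsSelfDual F (fun x y => psiE ψ' (x * y)) dxE) :
    dxE = (modulus (2 : F))⁻¹ • dx.prod dx := by
  have := hdx.haar
  have := hdxE.haar
  obtain ⟨φ, hφ, hφc, hφ0⟩ := exists_isSmooth_hasCompactSupport hF
  obtain ⟨c, rfl⟩ : ∃ c : ℝ≥0, dxE = c • dx.prod dx :=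
    ⟨_, Measure.isAddLeftInvariant_eq_smul dxE (dx.prod dx)⟩
  have hΦ : IsSchwartz F fun z : F × F => φ z.1 * φ z.2 := by
    have hs := hφ.prod_comp ![ContinuousLinearMap.fst F F F, ContinuousLinearMap.snd F F F]
    simp only [Fin.prod_univ_two, Matrix.cons_val_zero, Matrix.cons_val_one,
      ContinuousLinearMap.coe_fst', ContinuousLinearMap.coe_snd'] at hs
    refine hs.isSchwartz (HasCompactSupport.intro (IsCompact.prod hφc hφc) fun z hz => ?_)
    rcases not_and_or.mp (fun h => hz (Set.mem_prod.mpr h)) with h | h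
    · exact mul_eq_zero_of_left (image_eq_zero_of_notMem_tsupport h) _
    · exact mul_eq_zero_of_right _ (image_eq_zero_of_notMem_tsupport h)
  have hχ : ∀ x y : F × F, (psiE ψ' (x * y) : ℂ) =
      (ψ' (x.1 * (2⁻¹ * y.1)) : ℂ) * (ψ' (x.2 * (2⁻¹ * y.2)) : ℂ) := by
    intro x y
    rw [psiE, trE, ← Circle.coe_mul, ← AddChar.map_add_eq_mul]
    congr 2
    simp only [Prod.fst_mul, Prod.snd_mul]
    ring
  have h := hdxE.inversion _ hΦ 0
  simp only [hχ] at h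
  simp only [Prod.fst_zero, Prod.snd_zero, mul_zero, AddChar.map_zero_eq_one, Circle.coe_one,
    mul_one, neg_zero, hφ0, integral_smul_nnreal_measure, NNReal.smul_def,
    Complex.real_smul, mul_mul_mul_comm (φ _) (φ _)] at h
  have hin : ∀ y : F × F, ∫ x : F × F, φ x.1 * (ψ' (x.1 * (2⁻¹ * y.1)) : ℂ) *
      (φ x.2 * (ψ' (x.2 * (2⁻¹ * y.2)) : ℂ)) ∂(dx.prod dx) =
      (∫ x, φ x * (ψ' (x * (2⁻¹ * y.1)) : ℂ) ∂dx) *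
        ∫ x, φ x * (ψ' (x * (2⁻¹ * y.2)) : ℂ) ∂dx := fun y =>
    integral_prod_mul (fun x => φ x * (ψ' (x * (2⁻¹ * y.1)) : ℂ))
      fun x => φ x * (ψ' (x * (2⁻¹ * y.2)) : ℂ)
  simp only [hin, integral_const_mul] at h
  rw [integral_prod_mul (fun y => ∫ x, φ x * (ψ' (x * (2⁻¹ * y)) : ℂ) ∂dx)
      fun y => ∫ x, φ x * (ψ' (x * (2⁻¹ * y)) : ℂ) ∂dx,
    hdx.integral_fourier_mul_left (hφ.isSchwartz hφc) (inv_ne_zero h2), hφ0] at h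
  have h0 : modulus (2 : F) ≠ 0 := (modulus_pos (isUnit_iff_ne_zero.mpr h2)).ne'
  have hinv : modulus (2⁻¹ : F) = (modulus (2 : F))⁻¹ := by
    apply eq_inv_of_mul_eq_one_left
    rw [← modulus_mul, inv_mul_cancel₀ h2, modulus_one]
  rw [hinv] at h
  have h' : (c * modulus (2 : F)) ^ 2 = 1 := by
    have h'' : (((c : ℝ) : ℂ) * ((modulus (2 : F) : ℝ) : ℂ)) ^ 2 = 1 := by
      rw [← h]
      push_cast
      rw [inv_inv]
      ring
    exact_mod_cast h''
  rw [← eq_inv_of_mul_eq_one_left ((pow_eq_one_iff_of_nonneg zero_le two_ne_zero).mp h')]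

end SelfDual

/-! ### Matching in coordinates -/

section Matching

variable {F : Type*} [Field F] {n : ℕ}

lemma transposeGL_mul (g h : GL (Fin n) F) :
    transposeGL (g * h) = transposeGL h * transposeGL g := by
  ext1
  exact Matrix.transpose_mul _ _

lemma transposeGL_inv (g : GL (Fin n) F) : transposeGL g⁻¹ = (transposeGL g)⁻¹ := rfl

lemma fstGL_conjGL (g : GL (Fin n) (F × F)) : fstGL (conjGL g) = sndGL g := by
  ext i k
  rfl

lemma sndGL_conjGL (g : GL (Fin n) (F × F)) : sndGL (conjGL g) = fstGL g := by
  ext i k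
  rfl

lemma val_eq_pairMat (g : GL (Fin n) (F × F)) :
    g.val = pairMat (fstGL g).val (sndGL g).val := by
  ext i k <;> rfl

omit [Field F] in
lemma pairMat_inj {A B C D : Matrix (Fin n) (Fin n) F} (h : pairMat A B = pairMat C D) :
    A = C ∧ B = D :=
  ⟨by ext i k; exact congrArg Prod.fst (congrFun (congrFun h i) k),
    by ext i k; exact congrArg Prod.snd (congrFun (congrFun h i) k)⟩

lemma val_inv_betaSplit : (betaSplit F n)⁻¹.val = pairMat 1 (-1) := by
  have h : (betaSplit F n)⁻¹.val = pairMat 1 ((-1 : GL (Fin n) F)⁻¹).val := rfl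
  rw [h]
  simp

lemma hermNorm_betaSplit (ζ : GL (Fin n) (F × F)) :
    hermNorm (betaSplit F n) ζ =
      pairMat ((sndGL ζ).valᵀ * (fstGL ζ).val) ((fstGL ζ).valᵀ * (sndGL ζ).val) := by
  have hs : star' ζ.val = pairMat (sndGL ζ).valᵀ (fstGL ζ).valᵀ := by
    ext i k <;> simp [star', pairMat, conj, fstGL, sndGL]
  have hb : (betaSplit F n).val = pairMat 1 (-1) := rfl
  rw [hermNorm, val_inv_betaSplit, hs, hb, val_eq_pairMat ζ, pairMat_mul, pairMat_mul, pairMat_mul]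
  simp

lemma fst_vecMul (z : Fin n → F × F) (g : GL (Fin n) (F × F)) :
    (fun i => ((z ᵥ* g.val) i).1) = (fun i => (z i).1) ᵥ* (fstGL g).val := by
  funext i
  simp [Matrix.vecMul, dotProduct, fstGL, Prod.fst_sum]

lemma snd_vecMul (z : Fin n → F × F) (g : GL (Fin n) (F × F)) :
    (fun i => ((z ᵥ* g.val) i).2) = (fun i => (z i).2) ᵥ* (sndGL g).val := by
  funext i
  simp [Matrix.vecMul, dotProduct, sndGL, Prod.snd_sum]

lemma fst_mulVec (g : GL (Fin n) (F × F)) (y : Fin n → F × F) :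
    (fun i => ((g.val *ᵥ y) i).1) = (fstGL g).val *ᵥ fun i => (y i).1 := by
  funext i
  simp [Matrix.mulVec, dotProduct, fstGL, Prod.fst_sum]

lemma dualCol_betaSplit (z : Fin n → F × F) :
    dualCol (betaSplit F n) z = fun i => ((z i).2, -(z i).1) := by
  funext i
  rw [dualCol, val_inv_betaSplit]
  simp [Matrix.mulVec, dotProduct, pairMat, conj, Prod.ext_iff, Prod.fst_sum, Prod.snd_sum,
    Matrix.one_apply]

lemma symp_inL_inLdual (u v : Fin n → F) :
    symp (betaSplit F n) (inL u) (inLdual v) = u ⬝ᵥ v := by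
  rw [symp, dualCol_betaSplit]
  simp [trE, inL, inLdual, dotProduct, Prod.fst_sum, Prod.snd_sum]

/-- In coordinates, matching says that a single `h ∈ GL_n(F)` conjugates `γ₁` to `ζ₁` and `γ₂` to
`ᵗζ₂`, and carries `x` to `z₁` and `y₁` to `z₂`. -/
lemma Matches.exists_conj {S R : Set (GL (Fin n) (F × F))}
    (hSR : Compatible (betaSplit F n) S R) {γ : GL (Fin n) (F × F)} {x : Fin n → F}
    {y : Fin n → F × F} {ζ : GL (Fin n) (F × F)} {z : Fin n → F × F}
    (hm : Matches (betaSplit F n) S R γ x y ζ z) :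
    ∃ h : GL (Fin n) F, fstGL ζ = h⁻¹ * fstGL γ * h ∧
      sndGL ζ = transposeGL (h⁻¹ * sndGL γ * h) ∧
      (fun i => (z i).1) = x ᵥ* h.val ∧ h.val *ᵥ (fun i => (z i).2) = fun i => (y i).1 := by
  obtain ⟨h, h1, h2, h3⟩ := hm.sameOrbit
  have hζ := hSR γ hm.rssGL.mem ζ hm.rssUnitary.mem h h1
  have hfst : fstGL ζ = (fstGL h)⁻¹ * fstGL γ * fstGL h := by
    rw [hζ, map_mul, map_mul, map_inv]
  have hfstinv : fstGL h⁻¹ = (fstGL h)⁻¹ := map_inv _ _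
  refine ⟨fstGL h, hfst, ?_, ?_, ?_⟩
  · rw [hermNorm_betaSplit, val_eq_pairMat (Nm γ), val_eq_pairMat h, val_eq_pairMat h⁻¹,
      pairMat_mul, pairMat_mul] at h1
    have h4 := (pairMat_inj h1).1
    have hNm : fstGL (Nm γ) = sndGL γ * fstGL γ := by rw [Nm, map_mul, fstGL_conjGL]
    have h5 : transposeGL (sndGL ζ) * fstGL ζ =
        (fstGL h)⁻¹ * (sndGL γ * fstGL γ) * fstGL h := by
      ext1
      rw [← hNm, ← hfstinv]
      exact h4
    -- cancel `ζ₁ = h⁻¹ γ₁ h` in the first component `ᵗζ₂ ζ₁ = h⁻¹ γ₂ γ₁ h` of the norms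
    have h6 : transposeGL (sndGL ζ) = (fstGL h)⁻¹ * sndGL γ * fstGL h := by
      rw [hfst] at h5
      rw [eq_mul_inv_of_mul_eq h5]
      group
    rw [← h6]
    ext1
    exact (Matrix.transpose_transpose _).symm
  · have h4 := fst_vecMul (toE x) h
    rw [← h2] at h4
    exact h4
  · have h4 := fst_mulVec h⁻¹ y
    rw [← h3, hfstinv] at h4
    simp only [dualCol_betaSplit] at h4
    rw [h4, Matrix.mulVec_mulVec, Units.mul_inv, Matrix.one_mulVec]

end Matching

/-! ### The transfer factor -/

section TransferFactor

variable {F : Type*} [NontriviallyNormedField F] {n : ℕ}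

/-- The transfer factor of a matching pair is `1`: the determinant lies in `F^×`, where `μ` is
trivial. -/
lemma transferFactor_eq_one (μ : (F × F)ˣ →* Circle)
    (hμ : ∀ a : Fˣ, μ (pairUnit a a) = 1) {γ : GL (Fin n) (F × F)} (hγ : IsNormal γ)
    {x : Fin n → F} {y : Fin n → F × F} (hr : IsRssTriple (Nm γ).val (toE x) y) :
    transferFactor μ (Nm γ).val (toE x) = 1 := by
  obtain ⟨δ, hδ⟩ := hγ
  set M : Matrix (Fin n) (Fin n) (F × F) := Matrix.of fun i : Fin n => toE x ᵥ* (Nm γ).val ^ (i : ℕ)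
    with hM
  have hunit : IsUnit M.det := by
    rw [← Matrix.isUnit_iff_isUnit_det]
    rw [← Matrix.vecMul_surjective_iff_isUnit]
    intro v
    have hv : v ∈ Submodule.span (F × F) (Set.range M.row) := by
      have hspan : Submodule.span (F × F) (Set.range M.row) = ⊤ := hr.span_row
      rw [hspan]
      trivial
    rwa [← range_vecMulLinear] at hv
  have hdiag : M = (algebraMap F (F × F)).mapMatrix
      (Matrix.of fun i : Fin n => x ᵥ* δ.val ^ (i : ℕ)) := by
    have hpow : ∀ i : ℕ, (Nm γ).val ^ i = (algebraMap F (F × F)).mapMatrix (δ.val ^ i) := by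
      intro i
      rw [map_pow, hδ]
      rfl
    refine Matrix.ext fun i k => ?_
    simp only [hM, Matrix.of_apply, hpow, RingHom.mapMatrix_apply, Matrix.map_apply]
    rw [RingHom.map_vecMul]
    rfl
  set d : F := (Matrix.of fun i : Fin n => x ᵥ* δ.val ^ (i : ℕ)).det with hd
  have hdet : M.det = (d, d) := by
    rw [hdiag, ← RingHom.map_det]
    rfl
  have hd0 : d ≠ 0 := by
    rw [hdet, Prod.isUnit_iff] at hunit
    exact hunit.1.ne_zero
  rw [transferFactor, dif_pos hunit]
  have : hunit.unit = pairUnit (Units.mk0 d hd0) (Units.mk0 d hd0) := by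
    ext1
    exact hdet
  rw [this, hμ, Circle.coe_one]

end TransferFactor

/-! ### The partial Fourier transforms -/

section PartialFourier

variable {F : Type*} [NontriviallyNormedField F] [ProperSpace F] [MeasurableSpace F]
  [BorelSpace F] {n : ℕ}

lemma integral_comp_vecMul (dx : Measure F) [dx.IsAddHaarMeasure] (h : GL (Fin n) F)
    (H : (Fin n → F) → ℂ) :
    ∫ w, H w ∂(Measure.pi fun _ => dx) =
      ((modulus h.val.det : ℝ) : ℂ) * ∫ w, H (w ᵥ* h.val) ∂(Measure.pi fun _ => dx) := by
  let e : (Fin n → F) ≃ₜ (Fin n → F) :=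
    { toFun := (· ᵥ* h.val)
      invFun := (· ᵥ* h⁻¹.val)
      left_inv := fun w => by simp [Matrix.vecMul_vecMul]
      right_inv := fun w => by simp [Matrix.vecMul_vecMul]
      continuous_toFun := Continuous.matrix_vecMul continuous_id continuous_const
      continuous_invFun := Continuous.matrix_vecMul continuous_id continuous_const }
  have he : MeasurableEmbedding fun w : Fin n → F => w ᵥ* h.val := e.measurableEmbedding
  conv_lhs => rw [← modulus_det_smul_map_vecMul dx h]
  rw [integral_smul_nnreal_measure, he.integral_map, NNReal.smul_def, Complex.real_smul]

lemma integral_comp_smul (dx : Measure F) [dx.IsAddHaarMeasure] {c : F} (hc : c ≠ 0)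
    (H : (Fin n → F) → ℂ) :
    ∫ w, H w ∂(Measure.pi fun _ => dx) =
      ((modulus c : ℝ) : ℂ) ^ n * ∫ w, H (c • w) ∂(Measure.pi fun _ => dx) := by
  have he : MeasurableEmbedding fun w : Fin n → F => c • w :=
    (Homeomorph.smulOfNeZero c hc).measurableEmbedding
  conv_lhs => rw [← modulus_pow_smul_map_smul dx hc]
  rw [integral_smul_nnreal_measure, he.integral_map, NNReal.smul_def, Complex.real_smul]
  push_cast
  rfl

omit [MeasurableSpace F] [BorelSpace F] in
lemma modulus_neg_one : modulus (-1 : F) = 1 := by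
  have h : modulus (-1 : F) ^ 2 = 1 := by
    rw [sq, ← modulus_mul, neg_mul_neg, one_mul, modulus_one]
  exact (pow_eq_one_iff_of_nonneg zero_le two_ne_zero).mp h

/-- The integral `∫ φ₂((x + w) b) conj(φ₁((x - w) a)) ψ'(w · y) dw` over `F_n`, to which the complex
conjugate of `†` on the linear side and `‡` on the unitary side both reduce. -/
noncomputable def fourierPair (ψ' : AddChar F Circle) (dx : Measure F) (φ₁ φ₂ : (Fin n → F) → ℂ)
    (x y : Fin n → F) (a b : GL (Fin n) F) : ℂ :=
  ∫ w : Fin n → F, φ₂ ((x + w) ᵥ* b.val) * starRingEnd ℂ (φ₁ ((x - w) ᵥ* a.val)) *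
    (ψ' (w ⬝ᵥ y) : ℂ) ∂(Measure.pi fun _ => dx)

variable {ψ' : AddChar F Circle} {dx : Measure F} {φ₁ φ₂ : (Fin n → F) → ℂ}

/-- The substitution `w ↦ w h` in `fourierPair`. -/
lemma fourierPair_conj [dx.IsAddHaarMeasure] (h a b : GL (Fin n) F) (x y : Fin n → F) :
    fourierPair ψ' dx φ₁ φ₂ (x ᵥ* h.val) y a b =
      ((modulus h.val.det : ℝ) : ℂ) *
        fourierPair ψ' dx φ₁ φ₂ x (h.val *ᵥ y) (h * a) (h * b) := by
  rw [fourierPair, integral_comp_vecMul dx h]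
  simp only [fourierPair, ← Matrix.add_vecMul, ← Matrix.sub_vecMul, Matrix.vecMul_vecMul,
    Units.val_mul, Matrix.dotProduct_mulVec]

/-- The Fourier transform `†`, written on `E_n = F_n × F_n`. The factor `|j|^n` is absorbed by the
substitution `w ↦ j₁ w` for `j = (j₁, -j₁)`. -/
lemma conj_dagger [CharZero F] [dx.IsAddHaarMeasure] (μ : (F × F)ˣ →* Circle) {j : F × F}
    (hj : conj j = -j) (hj0 : j ≠ 0) {φ' : (Fin n → F × F) → ℂ}
    (hφ' : ∀ z, φ' z = φ₁ (fun i => (z i).1) * starRingEnd ℂ (φ₂ fun i => (z i).2))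
    (x : Fin n → F) {y : Fin n → F × F} (hy : ∀ i, conj (y i) = -y i) (g : GL (Fin n) (F × F)) :
    starRingEnd ℂ (dagger ψ' dx j (repGL μ g φ') x y) =
      starRingEnd ℂ (μ (GeneralLinearGroup.det g) : ℂ) *
        (Real.sqrt (modulus g.val.det) : ℂ) *
          fourierPair ψ' dx φ₁ φ₂ x (fun i => (y i).1) (fstGL g) (sndGL g) := by
  obtain ⟨j₁, j₂⟩ := j
  obtain rfl : j₂ = -j₁ := congrArg Prod.fst hj
  have hj1 : j₁ ≠ 0 := by
    rintro rfl
    exact hj0 (by simp)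
  have hy2 : ∀ i, (y i).2 = -(y i).1 := fun i => congrArg Prod.fst (hy i)
  have hmod : Real.sqrt (modulus ((j₁, -j₁) : F × F)) = modulus j₁ := by
    have : modulus (-j₁) = modulus j₁ := by
      rw [← neg_one_mul, modulus_mul, modulus_neg_one, one_mul]
    rw [modulus_split, this, NNReal.coe_mul]
    exact Real.sqrt_mul_self (NNReal.coe_nonneg _)
  have hψ : ∀ w : Fin n → F, psiE ψ' ((j₁, -j₁) * (toE w ⬝ᵥ y)) =
      ψ' ((j₁ • w) ⬝ᵥ fun i => (y i).1) := by
    intro w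
    have h1 : (toE w ⬝ᵥ y).1 = w ⬝ᵥ fun i => (y i).1 := by
      simp [toE, dotProduct, Prod.fst_sum]
    have h2 : (toE w ⬝ᵥ y).2 = -(w ⬝ᵥ fun i => (y i).1) := by
      simp [toE, dotProduct, Prod.snd_sum, hy2]
    rw [psiE, trE, Prod.fst_mul, Prod.snd_mul, h1, h2, neg_mul_neg, add_self_div_two,
      smul_dotProduct, smul_eq_mul]
  have hφ : ∀ w : Fin n → F, φ' ((toE x + (j₁, -j₁) • toE w) ᵥ* g.val) =
      φ₁ ((x + j₁ • w) ᵥ* (fstGL g).val) *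
        starRingEnd ℂ (φ₂ ((x - j₁ • w) ᵥ* (sndGL g).val)) := by
    intro w
    rw [hφ', fst_vecMul, snd_vecMul]
    have h1 : (fun i => ((toE x + (j₁, -j₁) • toE w) i).1) = x + j₁ • w := by
      funext i
      simp [toE]
    have h2 : (fun i => ((toE x + (j₁, -j₁) • toE w) i).2) = x - j₁ • w := by
      funext i
      simp [toE, sub_eq_add_neg]
    rw [h1, h2]
  simp only [dagger, repGL, hψ, hφ, hmod]
  have hJ := integral_comp_smul dx hj1 fun w : Fin n → F =>
    (μ (GeneralLinearGroup.det g) : ℂ) * (Real.sqrt (modulus g.val.det) : ℂ) *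
      (φ₁ ((x + w) ᵥ* (fstGL g).val) * starRingEnd ℂ (φ₂ ((x - w) ᵥ* (sndGL g).val))) *
        (ψ' (w ⬝ᵥ fun i => (y i).1) : ℂ)
  -- conjugation turns `ψ'(w · y)` into `ψ'(-w · y)`, which the substitution `w ↦ -w` undoes
  rw [Complex.ofReal_pow, ← hJ, ← integral_conj, fourierPair,
    integral_comp_smul dx (neg_ne_zero.mpr one_ne_zero), modulus_neg_one]
  simp only [NNReal.coe_one, Complex.ofReal_one, one_pow, one_mul, neg_smul, one_smul,
    neg_dotProduct, ← sub_eq_add_neg, sub_neg_eq_add, AddChar.map_neg_eq_inv]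
  rw [← integral_const_mul]
  refine integral_congr_ae (Filter.Eventually.of_forall fun w => ?_)
  simp only [map_mul, Complex.conj_ofReal, starRingEnd_self_apply,
    ← Circle.coe_inv_eq_conj, inv_inv]
  ring

/-- The Fourier transform `‡` at `z v`, for `v = (b, ᵗb⁻¹)`, after the substitution `w ↦ w b`. -/
lemma ddagger_weil [dx.IsAddHaarMeasure] (μ : (F × F)ˣ →* Circle) (a b : GL (Fin n) F)
    (z : Fin n → F × F) :
    ddagger ψ' dx φ₂ (fun w => starRingEnd ℂ (weil μ ((toUnitary b)⁻¹ * toUnitary a) φ₁ w))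
        (z ᵥ* (toUnitary b).val.val) =
      ((modulus b.val.det : ℝ) : ℂ) *
        (starRingEnd ℂ (μ (pairUnit (GeneralLinearGroup.det (b⁻¹ * a)) 1) : ℂ) *
          (Real.sqrt (modulus (b⁻¹ * a).val.det) : ℂ) *
            fourierPair ψ' dx φ₁ φ₂ (fun i => (z i).1) (fun i => (z i).2) a b) := by
  have hu : fstGL ((toUnitary b)⁻¹ * toUnitary a).val = b⁻¹ * a := by
    rw [Subgroup.coe_mul, Subgroup.coe_inv, map_mul, map_inv]
    exact congrArg₂ (fun s t => s⁻¹ * t) (fstGL_pairGL _ _) (fstGL_pairGL _ _)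
  have h1 : (fun i => ((z ᵥ* (toUnitary b).val.val) i).1) = (fun i => (z i).1) ᵥ* b.val :=
    fst_vecMul z _
  have h2 : (fun i => ((z ᵥ* (toUnitary b).val.val) i).2) =
      (fun i => (z i).2) ᵥ* (transposeGL b⁻¹).val := snd_vecMul z _
  have h3 : ∀ w : Fin n → F, (w ᵥ* b.val) ⬝ᵥ ((fun i => (z i).2) ᵥ* (transposeGL b⁻¹).val) =
      w ⬝ᵥ fun i => (z i).2 := by
    intro w
    have : (fun i => (z i).2) ᵥ* (transposeGL b⁻¹).val = b⁻¹.val *ᵥ fun i => (z i).2 :=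
      Matrix.vecMul_transpose _ _
    rw [this, Matrix.dotProduct_mulVec, Matrix.vecMul_vecMul, Units.mul_inv, Matrix.vecMul_one]
  simp only [ddagger, weil, hu, h1, h2, symp_inL_inLdual]
  rw [integral_comp_vecMul dx b]
  refine congrArg (((modulus b.val.det : ℝ) : ℂ) * ·) ?_
  rw [fourierPair, ← integral_const_mul]
  refine integral_congr_ae (Filter.Eventually.of_forall fun w => ?_)
  beta_reduce
  have h4 : ((fun i => (z i).1) ᵥ* b.val - w ᵥ* b.val) ᵥ* (b⁻¹ * a).val =
      ((fun i => (z i).1) - w) ᵥ* a.val := by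
    rw [← Matrix.sub_vecMul, Matrix.vecMul_vecMul, ← Units.val_mul, mul_inv_cancel_left]
  rw [h3, h4, ← Matrix.add_vecMul, map_mul, map_mul, Complex.conj_ofReal]
  ring

end PartialFourier

/-! ### Comparison of the integrands -/

section PointwiseIdentity

variable {F : Type*} [NontriviallyNormedField F] [ProperSpace F] [MeasurableSpace F]
  [BorelSpace F] {n : ℕ} {ψ' : AddChar F Circle} {dx : Measure F} {φ₁ φ₂ : (Fin n → F) → ℂ}

omit [ProperSpace F] [MeasurableSpace F] [BorelSpace F] in
lemma map_pairUnit_eq (μ : (F × F)ˣ →* Circle) (hμ : ∀ a : Fˣ, μ (pairUnit a a) = 1) (a b : Fˣ) :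
    μ (pairUnit a b) = μ (pairUnit (b⁻¹ * a) 1) := by
  have h : pairUnit a b = pairUnit b b * pairUnit (b⁻¹ * a) 1 := by
    rw [pairUnit, pairUnit, pairUnit, ← map_mul, Prod.mk_mul_mk, mul_inv_cancel_left, mul_one]
  rw [h, map_mul, hμ, one_mul]

omit [MeasurableSpace F] [BorelSpace F] in
lemma modulus_inv_mul {a b : F} (hb : b ≠ 0) : modulus b * modulus (b⁻¹ * a) = modulus a := by
  rw [← modulus_mul, mul_inv_cancel_left₀ hb]

/-- The integrand on the linear side at `(h a, h b)` is the one on the unitary side at the pair of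
unitary elements attached to `(a, b)`, up to the constant `κ` in `f̃'`, where `h ∈ GL_n(F)` realizes
the matching. -/
lemma integrandGL_pairGL [CharZero F] [dx.IsAddHaarMeasure] (μ : (F × F)ˣ →* Circle)
    (hμ : ∀ a : Fˣ, μ (pairUnit a a) = 1) {j : F × F} (hj : conj j = -j) (hj0 : j ≠ 0)
    {dxE : Measure (F × F)} {f₁ f₂ : GL (Fin n) F → ℂ} {f : GL (Fin n) (F × F) → ℂ}
    (hf : ∀ g, f g = f₁ (fstGL g) * f₂ (sndGL g))
    {f' : GL (Fin n) (F × F) × GL (Fin n) (F × F) → ℂ} {κ : ℂ}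
    (htilde : ∀ g, tilde dxE f' g = κ * (f₁ (fstGL g) * f₂ (transposeGL (sndGL g))))
    {φ' : (Fin n → F × F) → ℂ}
    (hφ' : ∀ z, φ' z = φ₁ (fun i => (z i).1) * starRingEnd ℂ (φ₂ fun i => (z i).2))
    {γ ζ : GL (Fin n) (F × F)} {x : Fin n → F} {y z : Fin n → F × F}
    (hy : ∀ i, conj (y i) = -y i) {h : GL (Fin n) F}
    (h₁ : fstGL ζ = h⁻¹ * fstGL γ * h) (h₂ : sndGL ζ = transposeGL (h⁻¹ * sndGL γ * h))
    (hz₁ : (fun i => (z i).1) = x ᵥ* h.val)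
    (hz₂ : h.val *ᵥ (fun i => (z i).2) = fun i => (y i).1) (a b : GL (Fin n) F) :
    integrandGL ψ' μ dx dxE j (1 / 2) γ x y f' φ' (pairGL (h * a) (h * b)) =
      κ * integrandU ψ' μ dx ζ z f φ₁ φ₂ (toUnitary a, toUnitary b) := by
  have hfst : ∀ g : GL (Fin n) F, fstGL (toUnitary g).val = g := fun g => fstGL_pairGL _ _
  have hsnd : ∀ g : GL (Fin n) F, sndGL (toUnitary g).val = (transposeGL g)⁻¹ := fun g =>
    sndGL_pairGL _ _
  have e₁ : (h * a)⁻¹ * fstGL γ * (h * b) = a⁻¹ * fstGL ζ * b := by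
    rw [h₁]
    group
  have e₂ : transposeGL ((h * b)⁻¹ * sndGL γ * (h * a)) =
      ((transposeGL a)⁻¹)⁻¹ * sndGL ζ * (transposeGL b)⁻¹ := by
    have : (h * b)⁻¹ * sndGL γ * (h * a) = b⁻¹ * ((h⁻¹ * sndGL γ * h) * a) := by group
    rw [h₂, this, transposeGL_mul, transposeGL_mul _ a, transposeGL_inv, inv_inv]
  have hdet : GeneralLinearGroup.det (pairGL (h * a) (h * b)) =
      pairUnit (GeneralLinearGroup.det (h * a)) (GeneralLinearGroup.det (h * b)) := by
    ext1
    exact Prod.ext (RingHom.map_det (RingHom.fst F F) _) (RingHom.map_det (RingHom.snd F F) _)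
  have hμdet : μ (GeneralLinearGroup.det (pairGL (h * a) (h * b))) =
      μ (pairUnit (GeneralLinearGroup.det (b⁻¹ * a)) 1) := by
    rw [hdet, map_pairUnit_eq μ hμ, ← map_inv, ← map_mul]
    congr 3
    group
  have hb0 : b.val.det ≠ 0 := (GeneralLinearGroup.det b).ne_zero
  have hmod : Real.sqrt (modulus (pairGL (h * a) (h * b)).val.det) =
      modulus h.val.det * modulus b.val.det * Real.sqrt (modulus (b⁻¹ * a).val.det) := by
    have hval : (pairGL (h * a) (h * b)).val.det = ((h * a).val.det, (h * b).val.det) :=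
      congrArg Units.val hdet
    have hba : (b⁻¹ * a).val.det = b.val.det⁻¹ * a.val.det := by
      rw [Units.val_mul, det_mul]
      congr 1
      exact (congrArg Units.val (map_inv GeneralLinearGroup.det b)).trans
        (Units.val_inv_eq_inv_val _)
    have hsq : ((modulus (pairGL (h * a) (h * b)).val.det : ℝ≥0) : ℝ) =
        (modulus h.val.det * modulus b.val.det) ^ 2 * modulus (b⁻¹ * a).val.det := by
      rw [hval, modulus_split, Units.val_mul, Units.val_mul, det_mul, det_mul, modulus_mul,
        modulus_mul, hba, ← modulus_inv_mul (a := a.val.det) hb0]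
      push_cast
      ring
    rw [hsq, Real.sqrt_mul (sq_nonneg _),
      Real.sqrt_sq (mul_nonneg (NNReal.coe_nonneg _) (NNReal.coe_nonneg _))]
  rw [integrandGL, integrandU, htilde, hf, sub_self, Complex.cpow_zero, mul_one,
    conj_dagger μ hj hj0 hφ' x hy, ddagger_weil, hz₁, fourierPair_conj, hz₂, hμdet, hmod]
  simp only [map_mul, map_inv, fstGL_pairGL, sndGL_pairGL, fstGL_conjGL, sndGL_conjGL, hfst, hsnd]
  rw [e₁, e₂]
  push_cast
  ring

end PointwiseIdentity

/-! ### Comparison of the measures -/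

section Comparison

variable {F : Type*} [NontriviallyNormedField F] [ProperSpace F] [MeasurableSpace F]
  [BorelSpace F] {n : ℕ}

instance sigmaFinite_pi_pi {α : Type*} [MeasurableSpace α] (ν : Measure α) [SigmaFinite ν] :
    SigmaFinite (Measure.pi fun _ : Fin n => Measure.pi fun _ : Fin n => ν) :=
  Measure.pi.sigmaFinite _

lemma pi_smul_nnreal {α : Type*} [MeasurableSpace α] (ν : Measure α) [SigmaFinite ν] (r : ℝ≥0) :
    (Measure.pi fun _ : Fin n => r • ν) = r ^ n • Measure.pi fun _ : Fin n => ν := by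
  refine Measure.pi_eq fun s _ => ?_
  simp only [Measure.smul_apply, Measure.pi_pi, ENNReal.smul_def, smul_eq_mul,
    Finset.prod_mul_distrib, Finset.prod_const, Finset.card_univ, Fintype.card_fin,
    ENNReal.coe_pow]

lemma detMeasure_smul {R : Type*} [NormedCommRing R] [ProperSpace R]
    [CompleteSpace R] [SecondCountableTopology R] [MeasurableSpace R] [BorelSpace R]
    (ν : Measure (Fin n → Fin n → R)) (r : ℝ≥0) :
    detMeasure (r • ν) = r • detMeasure ν := by
  apply eq_of_map_entries_eq
  rw [Measure.map_smul, map_entries_detMeasure, map_entries_detMeasure, ENNReal.smul_def,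
    withDensity_smul_measure, Measure.restrict_smul]
  rfl

omit [ProperSpace F] [MeasurableSpace F] [BorelSpace F] in
lemma zetaOneE_pos : 0 < zetaOneE F := by
  have h : zetaOne F ≠ 0 := by
    rw [zetaOne]
    split_ifs
    · refine inv_ne_zero (sub_ne_zero.mpr fun h => ?_)
      have h1 : Nat.card (IsLocalRing.ResidueField
          (NormedField.valuation (K := F)).valuationSubring) = 1 := by
        exact_mod_cast (inv_eq_one.mp h.symm)
      exact not_subsingleton _ (Nat.card_eq_one_iff_unique.mp h1).1
    · exact inv_ne_zero Real.pi_ne_zero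
    · exact one_ne_zero
  exact mul_self_pos.mpr h

/-- The measure of `GL_n(E)` in the coordinates `(h a, h b)`: it does not depend on `h`. -/
lemma measureGLE_eq (dx : Measure F) [dx.IsAddHaarMeasure] (r : ℝ≥0) (h : GL (Fin n) F) :
    measureGLE (n := n) (r • dx.prod dx) = ENNReal.ofReal (zetaOneE F) • (r ^ (n ^ 2)) •
      ((detMeasure (Measure.pi fun _ : Fin n => Measure.pi fun _ : Fin n => dx)).prod
        (detMeasure (Measure.pi fun _ : Fin n => Measure.pi fun _ : Fin n => dx))).map
          fun p => pairGL (h * p.1) (h * p.2) := by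
  have hmul : Measurable fun g : GL (Fin n) F => h * g := (continuous_const_mul h).measurable
  have hcomp : (fun p : GL (Fin n) F × GL (Fin n) F => pairGL (h * p.1) (h * p.2)) =
      (fun p => pairGL p.1 p.2) ∘ Prod.map (h * ·) (h * ·) := rfl
  have hs : SigmaFinite (Measure.pi fun _ : Fin n => dx.prod dx) := Measure.pi.sigmaFinite _
  rw [measureGLE, pi_smul_nnreal, pi_smul_nnreal, ← pow_mul, ← sq, detMeasure_smul,
    ← map_pairGL_detMeasure_prod, hcomp,
    ← Measure.map_map measurableEmbedding_pairGL.measurable (hmul.prodMap hmul),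
    ← Measure.map_prod_map _ _ hmul hmul, map_mul_left_detMeasure]

/-- The measure of `U × U` in the coordinates `(a, b)`. -/
lemma measureU_prod_eq (M : Measure (Fin n → Fin n → F)) [SigmaFinite M] (c : ℝ≥0) :
    (measureU (c • M)).prod (measureU (c • M)) =
      (((modulus (2 : F) ^ (n ^ 2))⁻¹ * c) ^ 2) •
        ((detMeasure M).prod (detMeasure M)).map (Prod.map toUnitary toUnitary) := by
  have hm := (measurableEmbedding_toUnitary (F := F) (n := n)).measurable
  have hs : SigmaFinite ((detMeasure M).map toUnitary) :=
    (measurableEmbedding_toUnitary (F := F) (n := n)).sigmaFinite_map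
  rw [measureU, detMeasure_smul, smul_smul, Measure.map_smul, Measure.prod_smul_left,
    Measure.prod_smul_right, smul_smul, ← sq, Measure.map_prod_map _ _ hm hm]

end Comparison

/-! ### Comparison of the integrals -/

section Integrals

variable {F : Type*} [NontriviallyNormedField F] [ProperSpace F] [MeasurableSpace F]
  [BorelSpace F] {n : ℕ}

/-- Two functions that agree up to the constant `ζ_E(1)⁻¹` in the coordinates `(h a, h b)` of
`GL_n(E)` and `(a, b)` of `U × U` have the same integral, for the measures attached to self-dual
measures: the powers of `|2|` cancel. -/
lemma integral_measureGLE_eq_integral_measureU (h2 : (2 : F) ≠ 0) (dx : Measure F)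
    [dx.IsAddHaarMeasure] {c : ℝ≥0} (hc : c ^ 2 = modulus (2 : F) ^ (n ^ 2)) (h : GL (Fin n) F)
    {A : GL (Fin n) (F × F) → ℂ}
    {B : unitaryGroup (betaSplit F n) × unitaryGroup (betaSplit F n) → ℂ}
    (hAB : ∀ a b, A (pairGL (h * a) (h * b)) =
      (((zetaOneE F)⁻¹ : ℝ) : ℂ) * B (toUnitary a, toUnitary b)) :
    let dXs := c • Measure.pi fun _ : Fin n => Measure.pi fun _ : Fin n => dx
    (Integrable A (measureGLE ((modulus (2 : F))⁻¹ • dx.prod dx)) ↔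
      Integrable B ((measureU dXs).prod (measureU dXs))) ∧
    ∫ g, A g ∂measureGLE ((modulus (2 : F))⁻¹ • dx.prod dx) =
      ∫ p, B p ∂(measureU dXs).prod (measureU dXs) := by
  intro dXs
  have hζ := zetaOneE_pos (F := F)
  have hζ0 : (((zetaOneE F)⁻¹ : ℝ) : ℂ) ≠ 0 := by exact_mod_cast (inv_pos.mpr hζ).ne'
  have hm0 : modulus (2 : F) ≠ 0 := (modulus_pos (isUnit_iff_ne_zero.mpr h2)).ne'
  have hK0 : (modulus (2 : F))⁻¹ ^ (n ^ 2) ≠ 0 := pow_ne_zero _ (inv_ne_zero hm0)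
  -- `c = |2|^{n²/2}` on `𝔲` and `|2|^{-n²}` from the Cayley transform, for both copies of `U`
  have hK : ((modulus (2 : F) ^ (n ^ 2))⁻¹ * c) ^ 2 = (modulus (2 : F))⁻¹ ^ (n ^ 2) := by
    rw [mul_pow, hc, sq, mul_assoc, inv_mul_cancel₀ (pow_ne_zero _ hm0), mul_one, inv_pow]
  have hE₁ : MeasurableEmbedding fun p : GL (Fin n) F × GL (Fin n) F =>
      pairGL (h * p.1) (h * p.2) :=
    measurableEmbedding_pairGL.comp ((Homeomorph.mulLeft h).measurableEmbedding.prodMap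
      (Homeomorph.mulLeft h).measurableEmbedding)
  have hE₂ : MeasurableEmbedding (Prod.map toUnitary toUnitary :
      GL (Fin n) F × GL (Fin n) F → _ × unitaryGroup (betaSplit F n)) :=
    measurableEmbedding_toUnitary.prodMap measurableEmbedding_toUnitary
  rw [measureGLE_eq dx _ h, measureU_prod_eq, hK]
  constructor
  · rw [integrable_smul_measure (ENNReal.ofReal_pos.mpr hζ).ne' ENNReal.ofReal_ne_top,
      ENNReal.smul_def, ENNReal.smul_def,
      integrable_smul_measure (ENNReal.coe_ne_zero.mpr hK0) ENNReal.coe_ne_top,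
      integrable_smul_measure (ENNReal.coe_ne_zero.mpr hK0) ENNReal.coe_ne_top,
      hE₁.integrable_map_iff, hE₂.integrable_map_iff,
      ← integrable_const_mul_iff (isUnit_iff_ne_zero.mpr hζ0) (B ∘ Prod.map toUnitary toUnitary)]
    exact iff_of_eq (congrArg (Integrable · _) (funext fun p => hAB p.1 p.2))
  · rw [integral_smul_measure, integral_smul_nnreal_measure, integral_smul_nnreal_measure,
      hE₁.integral_map, hE₂.integral_map, ENNReal.toReal_ofReal hζ.le, smul_comm]
    congr 1
    simp only [hAB, integral_const_mul]
    rw [Complex.real_smul, ← mul_assoc, ← Complex.ofReal_mul, mul_inv_cancel₀ hζ.ne',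
      Complex.ofReal_one, one_mul]
    rfl

end Integrals

end SplitTransfer

theorem proposition4p11 {F : Type*} [NontriviallyNormedField F] [ProperSpace F] [CharZero F]
    [MeasurableSpace F] [BorelSpace F]
    (hF : IsUltrametricDist F ∨ Nonempty (NormedAlgebra ℝ F)) (n : ℕ)
    (ψ' : AddChar F Circle) (hψ'_cont : Continuous ψ') (hψ' : ψ' ≠ 1)
    (μ : (F × F)ˣ →* Circle) (hμ_cont : Continuous μ)
    (hμ : ∀ a : Fˣ, μ (SplitTransfer.pairUnit a a) = 1)
    (j : F × F) (hj : SplitTransfer.conj j = -j) (hj0 : j ≠ 0)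
    (dx : MeasureTheory.Measure F)
    (hdx : SplitTransfer.IsSelfDual F (fun x y => ψ' (x * y)) dx)
    (dxE : MeasureTheory.Measure (F × F))
    (hdxE : SplitTransfer.IsSelfDual F (fun x y => SplitTransfer.psiE ψ' (x * y)) dxE)
    (dX : MeasureTheory.Measure (Fin n → Fin n → F))
    (hdX : SplitTransfer.IsSelfDual F (SplitTransfer.liePairing ψ') dX)
    (S R : Set (GL (Fin n) (F × F)))
    (hS : SplitTransfer.IsGLReps S)
    (hR : SplitTransfer.IsUnitaryReps (SplitTransfer.betaSplit F n) R)
    (hSR : SplitTransfer.Compatible (SplitTransfer.betaSplit F n) S R)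
    (f₁ f₂ : GL (Fin n) F → ℂ)
    (hf₁ : SplitTransfer.IsTestFunction F SplitTransfer.entries f₁)
    (hf₂ : SplitTransfer.IsTestFunction F SplitTransfer.entries f₂)
    (φ₁ φ₂ : (Fin n → F) → ℂ)
    (hφ₁ : SplitTransfer.IsSchwartz F φ₁) (hφ₂ : SplitTransfer.IsSchwartz F φ₂)
    (f : GL (Fin n) (F × F) → ℂ)
    (hf : ∀ g, f g = f₁ (SplitTransfer.fstGL g) * f₂ (SplitTransfer.sndGL g))
    (f' : GL (Fin n) (F × F) × GL (Fin n) (F × F) → ℂ)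
    (hf' : SplitTransfer.IsTestFunction F
      (Prod.map SplitTransfer.entries SplitTransfer.entries) f')
    (htilde : ∀ g, SplitTransfer.tilde dxE f' g =
      ((SplitTransfer.zetaOneE F)⁻¹ : ℝ) * (f₁ (SplitTransfer.fstGL g) *
        f₂ (SplitTransfer.transposeGL (SplitTransfer.sndGL g))))
    (φ' : (Fin n → F × F) → ℂ)
    (hφ' : ∀ z, φ' z = φ₁ (fun i => (z i).1) * starRingEnd ℂ (φ₂ fun i => (z i).2)) :
    SplitTransfer.IsSmoothTransfer ψ' μ dx dxE dX j S R f' φ' f φ₁ φ₂ ∧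
    ∀ γ x y ζ z, SplitTransfer.Matches (SplitTransfer.betaSplit F n) S R γ x y ζ z →
      (MeasureTheory.Integrable (SplitTransfer.integrandGL ψ' μ dx dxE j (1 / 2) γ x y f' φ')
          (SplitTransfer.measureGLE dxE) ↔
        MeasureTheory.Integrable (SplitTransfer.integrandU ψ' μ dx ζ z f φ₁ φ₂)
          ((SplitTransfer.measureU dX).prod (SplitTransfer.measureU dX))) ∧
      SplitTransfer.orbGL ψ' μ dx dxE j (1 / 2) γ x y f' φ' =
        SplitTransfer.orbU ψ' μ dx dX ζ z f φ₁ φ₂ := by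
  have := hdx.haar
  have h2 : (2 : F) ≠ 0 := two_ne_zero
  obtain ⟨c, hc, rfl⟩ := SplitTransfer.exists_lieMeasure_eq_smul hF h2 hdx hdX
  obtain rfl := SplitTransfer.measureE_eq_smul hF h2 hdx hdxE
  suffices key : ∀ γ x y ζ z, SplitTransfer.Matches (SplitTransfer.betaSplit F n) S R γ x y ζ z →
      _ ∧ SplitTransfer.orbGL ψ' μ dx _ j (1 / 2) γ x y f' φ' =
        SplitTransfer.orbU ψ' μ dx _ ζ z f φ₁ φ₂ by
    refine ⟨fun γ x y ζ z hm => ?_, key⟩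
    rw [SplitTransfer.transferFactor_eq_one μ hμ (hS.normal γ hm.rssGL.mem) hm.rssGL.rss, one_mul]
    exact (key γ x y ζ z hm).2
  intro γ x y ζ z hm
  obtain ⟨h, h₁, h₂, hz₁, hz₂⟩ := hm.exists_conj hSR
  exact SplitTransfer.integral_measureGLE_eq_integral_measureU h2 dx hc h
    (SplitTransfer.integrandGL_pairGL μ hμ hj hj0 hf htilde hφ' hm.rssGL.imaginary h₁ h₂ hz₁ hz₂)
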